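/- Let $G=\mathrm{Aff}_+(\mathbb R)=\{(x,y)\in\mathbb R^2: y>0\}$ with product $(x_2,y_2)\cdot(x_1,y_1)=(x_2+y_2x_1,\,y_2y_1)$, identity $\mathrm{Id}=(0,1)$ and left-invariant frame $X_1=y\,\partial_x$, $X_2=y\,\partial_y$. Let $A=\begin{pmatrix}a&b\\c&d\end{pmatrix}$ be a real matrix with $\det A>0$ and $a\ge 0$, and write $A^{-1}=\begin{pmatrix}\alpha&\beta\\\gamma&\delta\end{pmatrix}$, $Y_1=\alpha X_1+\gamma X_2$, $Y_2=\beta X_1+\delta X_2$. Equip $G$ with the left-invariant Lorentzian metric $g(u_1X_1+u_2X_2)=-(au_1+bu_2)^2+(cu_1+du_2)^2$, for which $Y_1,Y_2$ is an orthonormal frame with $Y_1$ timelike, and with the time orientation $Y_1$. Let $K$ be its (constant) sectional curvature. A future directed nonspacelike curve is a Lipschitzian curve $q:[0,T]\to G$ with $g(\dot q)\le 0$ and $g(\dot q,Y_1)<0$ a.e.; its length is $\int_0^T|g(\dot q)|^{1/2}dt$; it is an optimal trajectory (Lorentzian length maximizer) if no future directed nonspacelike curve with the same endpoints is longer; it is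 arclength-parametrized if $g(\dot q)=-1$ a.e. Let $J^+$ be the set of endpoints of future directed nonspacelike curves starting at $\mathrm{Id}$. For $q=(x,y)$ put $\lambda_1(q)=(c-a)x+(d-b)(y-1)$, $\lambda_2(q)=(c+a)x+(d+b)(y-1)$, and, if $K<0$, $\lambda_3(q)=\lambda_1(q)-\lambda_1\big(\tfrac{d+b}{c+a},0\big)$ and $D=\{q\in G:\lambda_1(q)\le 0\le\lambda_2(q),\ \lambda_3(q)>0\}$. Let $M=\operatorname{int}D$ if $K<0$ and $M=\operatorname{int}J^+$ if $K\ge0$. Let $h_i(\xi)=\langle \xi,Y_i\rangle$ and $H=\frac12(-h_1^2+h_2^2)$ on $T^*G$. For $\psi_0\in\mathbb R$ and $t\ge 0$ let $\mathrm{Exp}(\psi_0,t)\in G$ be the projection to $G$ of $e^{t\vec H}(\xi_0)$, where $\xi_0\in T^*_{\mathrm{Id}}G$ is the covector with $h_1(\xi_0)=-\cosh\psi_0$, $h_2(\xi_0)=\sinh\psi_0$, and let $N$ be the set of pairs $(\psi_0,t)$ such that $t>0$ and the solution exists on $[0,t]$. **Theorem.** The mapping $\mathrm{Exp}:N\to M$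 is bijective, and its inverse $\mathrm{Exp}^{-1}:M\to N$, $(x_1,y_1)\mapsto(\psi_0,t_1)$, is given as follows, where $s_1=\operatorname{sgn}\gamma$ and all expressions are well defined (denominators are nonzero, the arguments of $\arcsin$ lie in $(-1,1)$, the arguments of $\operatorname{arcosh}$ in the formulas for $\tau,\rho$ exceed $1$, the arguments of the square roots are positive). (1) If $K<0$, let $\Delta=\sqrt{\delta^2-\gamma^2}>0$, let $\theta=\operatorname{arsinh}(\gamma/\Delta)$, so that $\delta=\Delta\cosh\theta$, $\gamma=\Delta\sinh\theta$, and let $\lambda=\frac{\alpha\delta-\beta\gamma}{\Delta^2}$, $\nu=\frac{\beta\delta-\alpha\gamma}{\Delta^2}$. Then $$t_1=\frac{\tau-\rho}{\Delta},\quad \psi_0=\operatorname{arsinh}\tan\rho-\theta,\quad \tau=\arcsin\frac{y_1^2+w^2-1}{2y_1w},\quad \rho=\arcsin\frac{y_1^2-w^2-1}{2w},\quad w=\frac{x_1-\nu(y_1-1)}{\lambda}.$$ (2) If $K>0$, let $\Delta=\sqrt{\gamma^2-\delta^2}>0$, let $\theta=\operatorname{arsinh}(s_1\delta/\Delta)$,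 so that $\gamma=s_1\Delta\cosh\theta$, $\delta=s_1\Delta\sinh\theta$, let $\lambda=\frac{\alpha\delta-\beta\gamma}{\Delta^2}$, $\nu=\frac{\beta\delta-\alpha\gamma}{\Delta^2}$, and $w=\frac{x_1+\nu(y_1-1)}{\lambda}$. (2.1) If $w=0$, then $t_1=s_1\frac{\ln y_1}{\Delta}$ and $\psi_0=-\theta$. (2.2) If $w\ne0$, then $$t_1=s_1\frac{\rho-\tau}{\Delta},\quad \psi_0=s_2\operatorname{arcosh}\coth\rho-\theta,$$ $$\tau=\operatorname{arcosh}\Big(s_2\frac{1-y_1^2-w^2}{2y_1w}\Big),\quad \rho=\operatorname{arcosh}\Big(s_2\frac{1-y_1^2+w^2}{2w}\Big),\quad s_2=-s_1\operatorname{sgn}(\lambda w).$$ (3) If $K=0$, then $$t_1=\frac{\rho-\tau}{\gamma},\quad \psi_0=-s_1\ln\rho,\quad \tau=\sqrt{\frac{w}{y_1-y_1^2}},\quad \rho=\sqrt{\frac{wy_1}{1-y_1}},$$ $$w=\frac{x_1-g(1-y_1)}{f},\quad f=-\frac{\alpha-s_1\beta}{2\gamma},\quad g=-\frac{\alpha+s_1\beta}{2\gamma}$$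 (here $f$ and $g$ denote numbers). Moreover, for every $(x_1,y_1)\in M$ there is a unique arclength-parametrized optimal trajectory connecting $\mathrm{Id}$ to $(x_1,y_1)$, and it is $q(t)=\mathrm{Exp}(\psi_0,t)$, $t\in[0,t_1]$, with $(\psi_0,t_1)=\mathrm{Exp}^{-1}(x_1,y_1)$. -/

import Mathlib

open MeasureTheory

noncomputable section

namespace AffLorentz

/-! The group `Aff₊(ℝ) = {(x, y) : y > 0}` with product
`(x₂, y₂) · (x₁, y₁) = (x₂ + y₂ x₁, y₂ y₁)`, identity `(0, 1)`, and left-invariant frame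
`X₁ = y ∂/∂x`, `X₂ = y ∂/∂y`.  A pair `u = (u₁, u₂)` stands for the element `u₁ X₁ + u₂ X₂` of the
Lie algebra.  A left-invariant Lorentzian problem is given by a matrix
`A = (a, b; c, d)` with positive determinant. -/

/-- The underlying set of the group, an open half-plane. -/
def G : Set (ℝ × ℝ) := {q | 0 < q.2}

/-- The identity element of the group. -/
def Id : ℝ × ℝ := (0, 1)

/-- `v₁ = a u₁ + b u₂`. -/
def v₁ (A : Matrix (Fin 2) (Fin 2) ℝ) (u : ℝ × ℝ) : ℝ := A 0 0 * u.1 + A 0 1 * u.2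

/-- `v₂ = c u₁ + d u₂`. -/
def v₂ (A : Matrix (Fin 2) (Fin 2) ℝ) (u : ℝ × ℝ) : ℝ := A 1 0 * u.1 + A 1 1 * u.2

/-- The Lorentzian quadratic form `g = -v₁² + v₂²` on the Lie algebra. -/
def form (A : Matrix (Fin 2) (Fin 2) ℝ) (u : ℝ × ℝ) : ℝ := -(v₁ A u) ^ 2 + (v₂ A u) ^ 2

/-- The symmetric bilinear form of the quadratic form `form A`. -/
def bilin (A : Matrix (Fin 2) (Fin 2) ℝ) (u w : ℝ × ℝ) : ℝ :=
  -(v₁ A u * v₁ A w) + v₂ A u * v₂ A w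

/-- The timelike vector `Y₁ = α X₁ + γ X₂` of the orthonormal frame, where
`A⁻¹ = (α, β; γ, δ)`. -/
def Y₁ (A : Matrix (Fin 2) (Fin 2) ℝ) : ℝ × ℝ := (A⁻¹ 0 0, A⁻¹ 1 0)

/-- The spacelike vector `Y₂ = β X₁ + δ X₂` of the orthonormal frame. -/
def Y₂ (A : Matrix (Fin 2) (Fin 2) ℝ) : ℝ × ℝ := (A⁻¹ 0 1, A⁻¹ 1 1)

/-! ### Curvature -/

/-- The Lie bracket of left-invariant vector fields; `[X₂, X₁] = X₁`. -/
def bracket (u w : ℝ × ℝ) : ℝ × ℝ := (u.2 * w.1 - u.1 * w.2, 0)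

/-- `g(D_V W, X)` for left-invariant fields, by the Koszul formula (the three derivative terms
vanish, because `g` is constant on left-invariant fields). -/
def koszul (A : Matrix (Fin 2) (Fin 2) ℝ) (V W X : ℝ × ℝ) : ℝ :=
  (-bilin A V (bracket W X) + bilin A W (bracket X V) + bilin A X (bracket V W)) / 2

/-- The Levi-Civita connection on left-invariant fields: the vector whose inner products are
`koszul A V W`, expanded in the orthonormal frame `Y₁`, `Y₂`. -/
def connection (A : Matrix (Fin 2) (Fin 2) ℝ) (V W : ℝ × ℝ) : ℝ × ℝ :=
  -(koszul A V W (Y₁ A)) • Y₁ A + koszul A V W (Y₂ A) • Y₂ A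

/-- The curvature tensor `R_{XY} Z = D_{[X,Y]} Z - [D_X, D_Y] Z`. -/
def riemann (A : Matrix (Fin 2) (Fin 2) ℝ) (X Y Z : ℝ × ℝ) : ℝ × ℝ :=
  connection A (bracket X Y) Z
    - (connection A X (connection A Y Z) - connection A Y (connection A X Z))

/-- The sectional curvature `g(R_{vw} v, w) / (g(v,v) g(w,w) - g(v,w)²)` with `v = X₁`, `w = X₂`;
by left-invariance it is the same at all points. -/
def K (A : Matrix (Fin 2) (Fin 2) ℝ) : ℝ :=
  bilin A (riemann A (1, 0) (0, 1) (1, 0)) (0, 1) /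
    (bilin A (1, 0) (1, 0) * bilin A (0, 1) (0, 1) - bilin A (1, 0) (0, 1) ^ 2)

/-! ### Causal curves, length, maximizers -/

/-- The coordinates of the velocity of the curve `q` in the frame `X₁`, `X₂`. -/
def velocity (q : ℝ → ℝ × ℝ) (t : ℝ) : ℝ × ℝ :=
  ((deriv q t).1 / (q t).2, (deriv q t).2 / (q t).2)

/-- `q : [0, T] → G` is a future directed nonspacelike Lipschitzian curve from `q₀` to `q₁`;
the time orientation is given by `X₀ = Y₁`, for which `g(X₀, u) = -v₁`. -/
structure IsCausalCurve (A : Matrix (Fin 2) (Fin 2) ℝ) (q₀ q₁ : ℝ × ℝ) (T : ℝ)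
    (q : ℝ → ℝ × ℝ) : Prop where
  nonneg : 0 ≤ T
  lipschitz : ∃ C, LipschitzOnWith C q (Set.Icc 0 T)
  mem : ∀ t ∈ Set.Icc 0 T, q t ∈ G
  start : q 0 = q₀
  finish : q T = q₁
  causal : ∀ᵐ t ∂(volume.restrict (Set.Icc 0 T)),
    DifferentiableAt ℝ q t ∧ form A (velocity q t) ≤ 0 ∧ bilin A (Y₁ A) (velocity q t) < 0

/-- The Lorentzian length of a curve `q : [0, T] → G`. -/
def length (A : Matrix (Fin 2) (Fin 2) ℝ) (T : ℝ) (q : ℝ → ℝ × ℝ) : ℝ :=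
  ∫ t in (0 : ℝ)..T, √|form A (velocity q t)|

/-- `q : [0, T] → G` is a Lorentzian length maximizer (optimal trajectory) from `q₀` to `q₁`. -/
def IsMaximizer (A : Matrix (Fin 2) (Fin 2) ℝ) (q₀ q₁ : ℝ × ℝ) (T : ℝ) (q : ℝ → ℝ × ℝ) : Prop :=
  IsCausalCurve A q₀ q₁ T q ∧
    ∀ T' q', IsCausalCurve A q₀ q₁ T' q' → length A T' q' ≤ length A T q

/-- `q : [0, T] → G` is parametrized by arclength: `g(q̇, q̇) ≡ -1`. -/
def IsArclength (A : Matrix (Fin 2) (Fin 2) ℝ) (T : ℝ) (q : ℝ → ℝ × ℝ) : Prop :=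
  ∀ᵐ t ∂(volume.restrict (Set.Icc 0 T)), form A (velocity q t) = -1

/-- The causal future of a point. -/
def causalFuture (A : Matrix (Fin 2) (Fin 2) ℝ) (q₀ : ℝ × ℝ) : Set (ℝ × ℝ) :=
  {q₁ | ∃ T q, IsCausalCurve A q₀ q₁ T q}

/-! ### The domain `M` -/

/-- `λ₁(x, y) = (c - a) x + (d - b) (y - 1)`. -/
def lam₁ (A : Matrix (Fin 2) (Fin 2) ℝ) (q : ℝ × ℝ) : ℝ :=
  (A 1 0 - A 0 0) * q.1 + (A 1 1 - A 0 1) * (q.2 - 1)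

/-- `λ₂(x, y) = (c + a) x + (d + b) (y - 1)`. -/
def lam₂ (A : Matrix (Fin 2) (Fin 2) ℝ) (q : ℝ × ℝ) : ℝ :=
  (A 1 0 + A 0 0) * q.1 + (A 1 1 + A 0 1) * (q.2 - 1)

/-- `λ₃(q) = λ₁(q) - λ₁(B)`, `B = ((d + b) / (c + a), 0)` (used only if `K < 0`, when
`c + a ≠ 0`). -/
def lam₃ (A : Matrix (Fin 2) (Fin 2) ℝ) (q : ℝ × ℝ) : ℝ :=
  lam₁ A q - lam₁ A ((A 1 1 + A 0 1) / (A 1 0 + A 0 0), 0)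

/-- The set `D = {q ∈ G : λ₁(q) ≤ 0 ≤ λ₂(q), λ₃(q) > 0}`. -/
def D (A : Matrix (Fin 2) (Fin 2) ℝ) : Set (ℝ × ℝ) :=
  {q | q ∈ G ∧ lam₁ A q ≤ 0 ∧ 0 ≤ lam₂ A q ∧ 0 < lam₃ A q}

open Classical in
/-- `M = int D` if `K < 0`, and `M = int J⁺(Id)` if `K ≥ 0`. -/
def M (A : Matrix (Fin 2) (Fin 2) ℝ) : Set (ℝ × ℝ) :=
  if K A < 0 then interior (D A) else interior (causalFuture A Id)

/-! ### The Lorentzian exponential mapping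

A point of `T*G` is written `z = ((x, y), (p₁, p₂))` for the covector `p₁ dx + p₂ dy` at `(x, y)`. -/

/-- `h₁(z) = ⟨z, Y₁⟩`. -/
def h₁ (A : Matrix (Fin 2) (Fin 2) ℝ) (z : (ℝ × ℝ) × (ℝ × ℝ)) : ℝ :=
  z.2.1 * (z.1.2 * (Y₁ A).1) + z.2.2 * (z.1.2 * (Y₁ A).2)

/-- `h₂(z) = ⟨z, Y₂⟩`. -/
def h₂ (A : Matrix (Fin 2) (Fin 2) ℝ) (z : (ℝ × ℝ) × (ℝ × ℝ)) : ℝ :=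
  z.2.1 * (z.1.2 * (Y₂ A).1) + z.2.2 * (z.1.2 * (Y₂ A).2)

/-- The maximized Hamiltonian `H = (-h₁² + h₂²) / 2`. -/
def H (A : Matrix (Fin 2) (Fin 2) ℝ) (z : (ℝ × ℝ) × (ℝ × ℝ)) : ℝ :=
  (-(h₁ A z) ^ 2 + (h₂ A z) ^ 2) / 2

/-- The Hamiltonian vector field of `H` on `T*G`:
`ẋ = ∂H/∂p₁`, `ẏ = ∂H/∂p₂`, `ṗ₁ = -∂H/∂x`, `ṗ₂ = -∂H/∂y`. -/
def hamiltonianField (A : Matrix (Fin 2) (Fin 2) ℝ) (z : (ℝ × ℝ) × (ℝ × ℝ)) :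
    (ℝ × ℝ) × (ℝ × ℝ) :=
  ((deriv (fun s => H A (z.1, (s, z.2.2))) z.2.1,
    deriv (fun s => H A (z.1, (z.2.1, s))) z.2.2),
   (-deriv (fun s => H A ((s, z.1.2), z.2)) z.1.1,
    -deriv (fun s => H A ((z.1.1, s), z.2)) z.1.2))

/-- `z : [0, T] → T*G` is the trajectory of the Hamiltonian field that starts at the covector
`λ₀ ∈ T*_Id G` with `h₁(λ₀) = -cosh ψ₀`, `h₂(λ₀) = sinh ψ₀`. -/
structure IsNormalExtremal (A : Matrix (Fin 2) (Fin 2) ℝ) (ψ₀ T : ℝ)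
    (z : ℝ → (ℝ × ℝ) × (ℝ × ℝ)) : Prop where
  start : (z 0).1 = Id
  start_h₁ : h₁ A (z 0) = -Real.cosh ψ₀
  start_h₂ : h₂ A (z 0) = Real.sinh ψ₀
  mem : ∀ t ∈ Set.Icc 0 T, (z t).1 ∈ G
  ode : ∀ t ∈ Set.Icc 0 T, HasDerivWithinAt z (hamiltonianField A (z t)) (Set.Icc 0 T) t

/-- The domain of the exponential mapping: the pairs `(ψ₀, t)` with `0 < t < t_max(ψ₀)`, that is,
`t > 0` such that the trajectory of the Hamiltonian field exists on `[0, t]`. -/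
def N (A : Matrix (Fin 2) (Fin 2) ℝ) : Set (ℝ × ℝ) :=
  {p | 0 < p.2 ∧ ∃ z, IsNormalExtremal A p.1 p.2 z}

open Classical in
/-- The Lorentzian exponential mapping `Exp(ψ₀, t)`: the projection to `G` of the Hamiltonian
trajectory at time `t` (the trajectory on `[0, t]` is unique when it exists). -/
def Exp (A : Matrix (Fin 2) (Fin 2) ℝ) (p : ℝ × ℝ) : ℝ × ℝ :=
  if h : ∃ z, IsNormalExtremal A p.1 p.2 z then (h.choose p.2).1 else Id

/-- The inverse of the mapping `Exp : N → M`. -/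
def ExpInv (A : Matrix (Fin 2) (Fin 2) ℝ) : ℝ × ℝ → ℝ × ℝ :=
  Function.invFunOn (Exp A) (N A)

/-- The hyperbolic cotangent. -/
def coth (x : ℝ) : ℝ := Real.cosh x / Real.sinh x

end AffLorentz

end

/-! Put p = -λ₁, r = λ₂, m = (γ - δ)/2 and n = (γ + δ)/2 (`slope₁`, `slope₂`). In these light-cone
coordinates the group is the half-plane y = 1 + m p + n r > 0, the identity is the origin, the
metric is -dp dr / y², and K = 4mn (`K_eq`). The sign of κ = mn therefore only decides whether the
functions S = `gsin κ` and C = `gcos κ` are circular, linear or hyperbolic, and everything except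
the final formulas is done for all signs at once.

The Hamiltonian system is a Riccati equation for E = h₂ - h₁, with EF = 1 for F = -h₁ - h₂. It is
linearized by φ = C - n e S and χ = C - m f S, where e = exp ψ₀ and f = exp(-ψ₀). This gives p = f
S/χ, r = e S/φ, y = 1/(φχ), and the trajectory exists exactly as long as φ and χ stay positive
(`cone_solution`, `GeodesicExists.exists_extremal`). Moreover 1 + m p = C/χ and 1 + n r = C/φ, so
pr/y = S² recovers the time and r(1 + m p)/(p(1 + n r)) = e² recovers ψ₀. Hence `Exp` is a bijection
onto the set `future`, where p, r, y, 1 + m p and 1 + n r are positive (`bijOn_Exp_future`), and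
this set is M (`M_eq_future`).

For optimality, the function `lorentzDist`, equal to t at Exp(ψ₀, t), is a calibration: by the
inequality between arithmetic and geometric means it grows along every causal curve at least as fast
as length. A causal curve has zero length while it stays on the light cone of the identity, so no
curve to a point of M is longer than the geodesic (`IsCausalCurve.length_le`). Equality forces
`ratio` to be constant, which gives uniqueness (`IsCausalCurve.eq_geodesic`).

The explicit inverse comes from y and w, which up to sign is n r - m p (`cone_combination`): both
are simple functions of two parameters ρ and τ, where ρ depends only on ψ₀ and the difference of ρ
and τ is proportional to t. -/

namespace AffLorentz
open Set

/-! ### Generalized trigonometric functions -/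

/-- The solution of `f'' = κ f`, `f 0 = 1`, `f' 0 = 0`. -/
noncomputable def gcos (κ t : ℝ) : ℝ := if 0 < κ then Real.cosh (√κ * t) else Real.cos (√(-κ) * t)

/-- The solution of `f'' = κ f`, `f 0 = 0`, `f' 0 = 1`. -/
noncomputable def gsin (κ t : ℝ) : ℝ :=
  if 0 < κ then Real.sinh (√κ * t) / √κ
  else if κ < 0 then Real.sin (√(-κ) * t) / √(-κ) else t

/-- The inverse function of `gsin κ`. -/
noncomputable def garcsin (κ s : ℝ) : ℝ :=
  if 0 < κ then Real.arsinh (√κ * s) / √κ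
  else if κ < 0 then Real.arcsin (√(-κ) * s) / √(-κ) else s

theorem gcos_of_pos {κ : ℝ} (h : 0 < κ) (t : ℝ) : gcos κ t = Real.cosh (√κ * t) := if_pos h

theorem gcos_of_neg {κ : ℝ} (h : κ < 0) (t : ℝ) : gcos κ t = Real.cos (√(-κ) * t) :=
  if_neg h.le.not_gt

theorem gcos_zero_left (t : ℝ) : gcos 0 t = 1 := by simp [gcos]

theorem gsin_of_pos {κ : ℝ} (h : 0 < κ) (t : ℝ) : gsin κ t = Real.sinh (√κ * t) / √κ := if_pos h

theorem gsin_of_neg {κ : ℝ} (h : κ < 0) (t : ℝ) : gsin κ t = Real.sin (√(-κ) * t) / √(-κ) := by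
  simp [gsin, h, h.le.not_gt]

theorem gsin_zero_left (t : ℝ) : gsin 0 t = t := by simp [gsin]

theorem garcsin_of_pos {κ : ℝ} (h : 0 < κ) (s : ℝ) :
    garcsin κ s = Real.arsinh (√κ * s) / √κ := if_pos h

theorem garcsin_of_neg {κ : ℝ} (h : κ < 0) (s : ℝ) :
    garcsin κ s = Real.arcsin (√(-κ) * s) / √(-κ) := by
  simp [garcsin, h, h.le.not_gt]

theorem garcsin_zero_left (s : ℝ) : garcsin 0 s = s := by simp [garcsin]

@[simp] theorem gcos_zero (κ : ℝ) : gcos κ 0 = 1 := by simp [gcos]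

@[simp] theorem gsin_zero (κ : ℝ) : gsin κ 0 = 0 := by simp [gsin]

@[simp] theorem garcsin_zero (κ : ℝ) : garcsin κ 0 = 0 := by simp [garcsin]

theorem hasDerivAt_gsin (κ t : ℝ) : HasDerivAt (gsin κ) (gcos κ t) t := by
  rcases lt_trichotomy κ 0 with h | rfl | h
  · have hk : √(-κ) ≠ 0 := (Real.sqrt_pos.2 (by linarith)).ne'
    rw [funext (gsin_of_neg h), gcos_of_neg h]
    exact (((hasDerivAt_id' t).const_mul √(-κ)).sin.div_const √(-κ)).congr_deriv (by field_simp)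
  · rw [funext gsin_zero_left, gcos_zero_left]; exact hasDerivAt_id t
  · have hk : √κ ≠ 0 := (Real.sqrt_pos.2 h).ne'
    rw [funext (gsin_of_pos h), gcos_of_pos h]
    exact (((hasDerivAt_id' t).const_mul √κ).sinh.div_const √κ).congr_deriv (by field_simp)

theorem hasDerivAt_gcos (κ t : ℝ) : HasDerivAt (gcos κ) (κ * gsin κ t) t := by
  rcases lt_trichotomy κ 0 with h | rfl | h
  · have hk : √(-κ) ≠ 0 := (Real.sqrt_pos.2 (by linarith)).ne'
    have hk2 : √(-κ) ^ 2 = -κ := Real.sq_sqrt (by linarith)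
    rw [funext (gcos_of_neg h), gsin_of_neg h]
    refine ((hasDerivAt_id' t).const_mul √(-κ)).cos.congr_deriv ?_
    field_simp; rw [hk2]; ring
  · rw [funext gcos_zero_left]; simpa using hasDerivAt_const t (1 : ℝ)
  · have hk : √κ ≠ 0 := (Real.sqrt_pos.2 h).ne'
    have hk2 : √κ ^ 2 = κ := Real.sq_sqrt h.le
    rw [funext (gcos_of_pos h), gsin_of_pos h]
    refine ((hasDerivAt_id' t).const_mul √κ).cosh.congr_deriv ?_
    field_simp; rw [hk2]; ring

theorem continuous_gcos (κ : ℝ) : Continuous (gcos κ) :=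
  continuous_iff_continuousAt.2 fun t => (hasDerivAt_gcos κ t).continuousAt

theorem continuous_gsin (κ : ℝ) : Continuous (gsin κ) :=
  continuous_iff_continuousAt.2 fun t => (hasDerivAt_gsin κ t).continuousAt

theorem gcos_sq (κ t : ℝ) : gcos κ t ^ 2 = 1 + κ * gsin κ t ^ 2 := by
  rcases lt_trichotomy κ 0 with h | rfl | h
  · have hk : √(-κ) ≠ 0 := (Real.sqrt_pos.2 (by linarith)).ne'
    have hk2 : √(-κ) ^ 2 = -κ := Real.sq_sqrt (by linarith)
    rw [gcos_of_neg h, gsin_of_neg h, div_pow, hk2, Real.cos_sq']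
    have := h.ne; field_simp; ring
  · simp [gcos_zero_left]
  · have hk2 : √κ ^ 2 = κ := Real.sq_sqrt h.le
    rw [gcos_of_pos h, gsin_of_pos h, div_pow, hk2, Real.cosh_sq]
    field_simp; ring

/-- The monotonicity of `gsin κ` as long as `gcos κ` is positive. -/
theorem gsin_lt_gsin {κ T s t : ℝ} (hC : ∀ r ∈ Icc 0 T, 0 < gcos κ r) (hs : 0 ≤ s) (hst : s < t)
    (ht : t ≤ T) : gsin κ s < gsin κ t := by
  have : StrictMonoOn (gsin κ) (Icc 0 T) := by
    refine strictMonoOn_of_deriv_pos (convex_Icc 0 T) (continuous_gsin κ).continuousOn ?_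
    intro r hr
    rw [(hasDerivAt_gsin κ r).deriv]
    exact hC r (interior_subset hr)
  exact this ⟨hs, hst.le.trans ht⟩ ⟨hs.trans hst.le, ht⟩ hst

theorem gsin_pos {κ t : ℝ} (hC : ∀ r ∈ Icc 0 t, 0 < gcos κ r) (ht : 0 < t) : 0 < gsin κ t := by
  simpa using gsin_lt_gsin hC le_rfl ht le_rfl

theorem hasDerivAt_garcsin {κ s : ℝ} (h : 0 < 1 + κ * s ^ 2) :
    HasDerivAt (garcsin κ) (1 / √(1 + κ * s ^ 2)) s := by
  rcases lt_trichotomy κ 0 with hκ | rfl | hκ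
  · have hk : √(-κ) ≠ 0 := (Real.sqrt_pos.2 (by linarith)).ne'
    have hk2 : √(-κ) ^ 2 = -κ := Real.sq_sqrt (by linarith)
    have h1 : (√(-κ) * s) ^ 2 < 1 := by rw [mul_pow, hk2]; linarith
    rw [sq_lt_one_iff_abs_lt_one, abs_lt] at h1
    rw [funext (garcsin_of_neg hκ)]
    have h2 := (Real.hasDerivAt_arcsin h1.1.ne' h1.2.ne).comp s
      ((hasDerivAt_id' s).const_mul √(-κ))
    refine (h2.div_const √(-κ)).congr_deriv ?_
    rw [mul_pow, hk2]
    simp only [mul_one]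
    rw [mul_div_assoc, div_self hk, mul_one]
    congr 2
    ring
  · rw [funext garcsin_zero_left]; simpa using hasDerivAt_id' s
  · have hk : √κ ≠ 0 := (Real.sqrt_pos.2 hκ).ne'
    have hk2 : √κ ^ 2 = κ := Real.sq_sqrt hκ.le
    rw [funext (garcsin_of_pos hκ)]
    have h2 := (Real.hasDerivAt_arsinh (√κ * s)).comp s ((hasDerivAt_id' s).const_mul √κ)
    refine (h2.div_const √κ).congr_deriv ?_
    rw [mul_pow, hk2]
    simp only [mul_one]
    rw [mul_div_assoc, div_self hk, mul_one, one_div]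

theorem contDiffAt_garcsin {κ s : ℝ} (h : 0 < 1 + κ * s ^ 2) : ContDiffAt ℝ 1 (garcsin κ) s := by
  rcases lt_trichotomy κ 0 with hκ | rfl | hκ
  · have hk : √(-κ) ≠ 0 := (Real.sqrt_pos.2 (by linarith)).ne'
    have hk2 : √(-κ) ^ 2 = -κ := Real.sq_sqrt (by linarith)
    have h1 : (√(-κ) * s) ^ 2 < 1 := by rw [mul_pow, hk2]; linarith
    rw [sq_lt_one_iff_abs_lt_one, abs_lt] at h1
    rw [funext (garcsin_of_neg hκ)]
    have := Real.contDiffAt_arcsin (n := 1) h1.1.ne' h1.2.ne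
    exact (this.comp s (contDiffAt_const.mul contDiffAt_id)).div_const _
  · rw [funext garcsin_zero_left]; exact contDiffAt_id
  · rw [funext (garcsin_of_pos hκ)]
    exact (Real.contDiff_arsinh.contDiffAt.comp s (contDiffAt_const.mul contDiffAt_id)).div_const _

/-- Used to verify first integrals. Derivatives within the interval suffice, which matches the
one-sided differential equation in `IsNormalExtremal`. -/
theorem eq_of_hasDerivWithinAt_zero {f : ℝ → ℝ} {T : ℝ}
    (h : ∀ t ∈ Icc 0 T, HasDerivWithinAt f 0 (Icc 0 T) t) : ∀ t ∈ Icc 0 T, f t = f 0 :=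
  constant_of_has_deriv_right_zero (fun t ht => (h t ht).continuousWithinAt) fun t ht =>
    ((h t ⟨ht.1, ht.2.le⟩).mono (Icc_subset_Icc_left ht.1)).mono_of_mem_nhdsWithin
      (Icc_mem_nhdsGE ht.2)

/-- The composite has derivative gcos / √(gcos²), which is 1 as long as `gcos κ` is positive; for κ
< 0 this keeps t inside the first quarter period. -/
theorem garcsin_gsin {κ t : ℝ} (ht : 0 ≤ t) (hC : ∀ r ∈ Icc 0 t, 0 < gcos κ r) :
    garcsin κ (gsin κ t) = t := by
  have key := eq_of_hasDerivWithinAt_zero (f := fun r => garcsin κ (gsin κ r) - r) (T := t) ?_ t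
    ⟨ht, le_rfl⟩
  · simp at key; linarith
  intro r hr
  have h0 : 0 < 1 + κ * gsin κ r ^ 2 := by rw [← gcos_sq]; exact pow_pos (hC r hr) 2
  have := ((hasDerivAt_garcsin h0).comp r (hasDerivAt_gsin κ r)).sub (hasDerivAt_id r)
  refine (this.congr_deriv ?_).hasDerivWithinAt
  rw [← gcos_sq, Real.sqrt_sq (hC r hr).le, one_div_mul_cancel (hC r hr).ne', sub_self]

/-- `gsin κ` takes every positive value `s` with `0 < 1 + κ s²` before `gcos κ` vanishes. -/
theorem exists_gsin_eq {κ s : ℝ} (hs : 0 < s) (h : 0 < 1 + κ * s ^ 2) :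
    ∃ t, 0 < t ∧ gsin κ t = s ∧ ∀ r ∈ Icc 0 t, 0 < gcos κ r := by
  rcases lt_trichotomy κ 0 with hκ | rfl | hκ
  · have hk : 0 < √(-κ) := Real.sqrt_pos.2 (by linarith)
    have hk2 : √(-κ) ^ 2 = -κ := Real.sq_sqrt (by linarith)
    have h1 : (√(-κ) * s) ^ 2 < 1 := by rw [mul_pow, hk2]; linarith
    rw [sq_lt_one_iff_abs_lt_one, abs_lt] at h1
    refine ⟨Real.arcsin (√(-κ) * s) / √(-κ), div_pos (Real.arcsin_pos.2 (by positivity)) hk, ?_, ?_⟩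
    · rw [gsin_of_neg hκ, mul_div_cancel₀ _ hk.ne', Real.sin_arcsin h1.1.le h1.2.le,
        mul_div_cancel_left₀ _ hk.ne']
    · intro r hr
      rw [gcos_of_neg hκ]
      have h2 := (le_div_iff₀ hk).1 hr.2
      have h3 := Real.arcsin_lt_pi_div_two.2 h1.2
      have h4 := mul_nonneg hk.le hr.1
      exact Real.cos_pos_of_mem_Ioo ⟨by linarith [Real.pi_pos], by linarith⟩
  · exact ⟨s, hs, gsin_zero_left s, fun r _ => by simp [gcos_zero_left]⟩
  · have hk : 0 < √κ := Real.sqrt_pos.2 hκ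
    refine ⟨Real.arsinh (√κ * s) / √κ, div_pos (Real.arsinh_pos_iff.2 (by positivity)) hk, ?_, ?_⟩
    · rw [gsin_of_pos hκ, mul_div_cancel₀ _ hk.ne', Real.sinh_arsinh, mul_div_cancel_left₀ _ hk.ne']
    · intro r _; rw [gcos_of_pos hκ]; exact Real.cosh_pos _

/-! ### Light-cone coordinates -/

/-- `(γ - δ) / 2`, the coefficient of the first light-cone coordinate in `y`. -/
noncomputable def slope₁ (A : Matrix (Fin 2) (Fin 2) ℝ) : ℝ := (A⁻¹ 1 0 - A⁻¹ 1 1) / 2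

/-- `(γ + δ) / 2`, the coefficient of the second light-cone coordinate in `y`. -/
noncomputable def slope₂ (A : Matrix (Fin 2) (Fin 2) ℝ) : ℝ := (A⁻¹ 1 0 + A⁻¹ 1 1) / 2

/-- The point with `-λ₁ = p` and `λ₂ = r`. -/
noncomputable def ofCone (A : Matrix (Fin 2) (Fin 2) ℝ) (p r : ℝ) : ℝ × ℝ :=
  (((A⁻¹ 0 0 - A⁻¹ 0 1) * p + (A⁻¹ 0 0 + A⁻¹ 0 1) * r) / 2, 1 + slope₁ A * p + slope₂ A * r)

/-! ### The inverse matrix, the change of coordinates and the curvature -/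

section Inverse

variable {A : Matrix (Fin 2) (Fin 2) ℝ}

theorem inv_zero_zero (A : Matrix (Fin 2) (Fin 2) ℝ) : A⁻¹ 0 0 = A 1 1 / A.det := by
  simp [Matrix.inv_def, Matrix.adjugate_fin_two, div_eq_inv_mul]

theorem inv_zero_one (A : Matrix (Fin 2) (Fin 2) ℝ) : A⁻¹ 0 1 = -A 0 1 / A.det := by
  simp [Matrix.inv_def, Matrix.adjugate_fin_two, div_eq_inv_mul]

theorem inv_one_zero (A : Matrix (Fin 2) (Fin 2) ℝ) : A⁻¹ 1 0 = -A 1 0 / A.det := by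
  simp [Matrix.inv_def, Matrix.adjugate_fin_two, div_eq_inv_mul]

theorem inv_one_one (A : Matrix (Fin 2) (Fin 2) ℝ) : A⁻¹ 1 1 = A 0 0 / A.det := by
  simp [Matrix.inv_def, Matrix.adjugate_fin_two, div_eq_inv_mul]

theorem mul_inv_zero_zero (hA : A.det ≠ 0) : A 0 0 * A⁻¹ 0 0 + A 0 1 * A⁻¹ 1 0 = 1 := by
  rw [inv_zero_zero, inv_one_zero]; field_simp; rw [Matrix.det_fin_two]; ring

theorem mul_inv_zero_one (A : Matrix (Fin 2) (Fin 2) ℝ) :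
    A 0 0 * A⁻¹ 0 1 + A 0 1 * A⁻¹ 1 1 = 0 := by
  rw [inv_zero_one, inv_one_one]; ring

theorem mul_inv_one_zero (A : Matrix (Fin 2) (Fin 2) ℝ) :
    A 1 0 * A⁻¹ 0 0 + A 1 1 * A⁻¹ 1 0 = 0 := by
  rw [inv_zero_zero, inv_one_zero]; ring

theorem mul_inv_one_one (hA : A.det ≠ 0) : A 1 0 * A⁻¹ 0 1 + A 1 1 * A⁻¹ 1 1 = 1 := by
  rw [inv_zero_one, inv_one_one]; field_simp; rw [Matrix.det_fin_two]; ring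

theorem inv_mul_one_zero (A : Matrix (Fin 2) (Fin 2) ℝ) :
    A 0 0 * A⁻¹ 1 0 + A 1 0 * A⁻¹ 1 1 = 0 := by
  rw [inv_one_zero, inv_one_one]; ring

theorem inv_mul_one_one (hA : A.det ≠ 0) : A 0 1 * A⁻¹ 1 0 + A 1 1 * A⁻¹ 1 1 = 1 := by
  rw [inv_one_zero, inv_one_one]; field_simp; rw [Matrix.det_fin_two]; ring

theorem det_mul_det_inv (hA : A.det ≠ 0) :
    A.det * (A⁻¹ 0 0 * A⁻¹ 1 1 - A⁻¹ 0 1 * A⁻¹ 1 0) = 1 := by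
  rw [inv_zero_zero, inv_one_zero, inv_zero_one, inv_one_one]
  field_simp; rw [Matrix.det_fin_two]; ring

theorem snd_eq_cone (hA : A.det ≠ 0) (q : ℝ × ℝ) :
    q.2 = 1 + slope₁ A * -lam₁ A q + slope₂ A * lam₂ A q := by
  unfold slope₁ slope₂ lam₁ lam₂
  rw [inv_one_zero, inv_one_one]; field_simp; rw [Matrix.det_fin_two]; ring

theorem lam₁_ofCone (hA : A.det ≠ 0) (p r : ℝ) : lam₁ A (ofCone A p r) = -p := by
  unfold lam₁ ofCone slope₁ slope₂
  rw [inv_zero_zero, inv_one_zero, inv_zero_one, inv_one_one]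
  field_simp; rw [Matrix.det_fin_two]; ring

theorem lam₂_ofCone (hA : A.det ≠ 0) (p r : ℝ) : lam₂ A (ofCone A p r) = r := by
  unfold lam₂ ofCone slope₁ slope₂
  rw [inv_zero_zero, inv_one_zero, inv_zero_one, inv_one_one]
  field_simp; rw [Matrix.det_fin_two]; ring

theorem ofCone_lam (hA : A.det ≠ 0) (q : ℝ × ℝ) : ofCone A (-lam₁ A q) (lam₂ A q) = q := by
  ext
  · unfold lam₁ lam₂ ofCone
    rw [inv_zero_zero, inv_zero_one]
    field_simp; rw [Matrix.det_fin_two]; ring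
  · exact (snd_eq_cone hA q).symm

theorem lam₁_Id (A : Matrix (Fin 2) (Fin 2) ℝ) : lam₁ A Id = 0 := by simp [lam₁, Id]

theorem lam₂_Id (A : Matrix (Fin 2) (Fin 2) ℝ) : lam₂ A Id = 0 := by simp [lam₂, Id]

/-- Identifies the third inequality in the definition of `D` with 1 + m p > 0, up to the sign of c +
a. -/
theorem lam₃_eq (hA : A.det ≠ 0) (hs : A 1 0 + A 0 0 ≠ 0) (q : ℝ × ℝ) :
    lam₃ A q = 2 * A.det / (A 1 0 + A 0 0) * (1 + slope₁ A * -lam₁ A q) := by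
  unfold lam₃ slope₁ lam₁
  rw [inv_one_zero, inv_one_one]; field_simp; rw [Matrix.det_fin_two]; ring

theorem bilin_Y₁ (hA : A.det ≠ 0) (u : ℝ × ℝ) : bilin A (Y₁ A) u = -v₁ A u := by
  have h1 : v₁ A (Y₁ A) = 1 := mul_inv_zero_zero hA
  have h2 : v₂ A (Y₁ A) = 0 := mul_inv_one_zero A
  rw [bilin, h1, h2]; ring

/-- The connection form of the orthonormal frame. -/
noncomputable def connectionForm (A : Matrix (Fin 2) (Fin 2) ℝ) (V : ℝ × ℝ) : ℝ :=
  (-A 0 0 * v₁ A V + A 1 0 * v₂ A V) / A.det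

theorem v₁_connection_aux (hA : A.det ≠ 0) (V W : ℝ × ℝ) :
    koszul A V W (Y₁ A) = -(connectionForm A V * v₂ A W) := by
  rw [koszul, Y₁, inv_zero_zero, inv_one_zero, connectionForm]
  simp only [bracket, bilin, v₁, v₂]
  field_simp
  rw [Matrix.det_fin_two]
  ring

theorem v₂_connection_aux (hA : A.det ≠ 0) (V W : ℝ × ℝ) :
    koszul A V W (Y₂ A) = connectionForm A V * v₁ A W := by
  rw [koszul, Y₂, inv_zero_one, inv_one_one, connectionForm]
  simp only [bracket, bilin, v₁, v₂]
  field_simp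
  rw [Matrix.det_fin_two]
  ring

/-- A metric connection acts in a Lorentzian orthonormal frame by infinitesimal boosts, which
exchange the two components up to a common factor. With `v₂_connection` this reduces the curvature
to the value of one 1-form. -/
theorem v₁_connection (hA : A.det ≠ 0) (V W : ℝ × ℝ) :
    v₁ A (connection A V W) = connectionForm A V * v₂ A W := by
  have h1 := mul_inv_zero_zero hA
  have h2 := mul_inv_zero_one A
  rw [connection, v₁_connection_aux hA, v₂_connection_aux hA]
  simp only [v₁, Y₁, Y₂, Prod.smul_mk, smul_eq_mul, Prod.mk_add_mk, neg_neg] at *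
  linear_combination (connectionForm A V * v₂ A W) * h1 +
    connectionForm A V * (A 0 0 * W.1 + A 0 1 * W.2) * h2

theorem v₂_connection (hA : A.det ≠ 0) (V W : ℝ × ℝ) :
    v₂ A (connection A V W) = connectionForm A V * v₁ A W := by
  have h1 := mul_inv_one_zero A
  have h2 := mul_inv_one_one hA
  rw [connection, v₁_connection_aux hA, v₂_connection_aux hA]
  simp only [v₂, Y₁, Y₂, Prod.smul_mk, smul_eq_mul, Prod.mk_add_mk, neg_neg] at *
  linear_combination (connectionForm A V * (A 1 0 * W.1 + A 1 1 * W.2)) * h1 +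
    connectionForm A V * v₁ A W * h2

theorem v₁_sub (A : Matrix (Fin 2) (Fin 2) ℝ) (u w : ℝ × ℝ) : v₁ A (u - w) = v₁ A u - v₁ A w := by
  simp only [v₁, Prod.fst_sub, Prod.snd_sub]; ring

theorem v₂_sub (A : Matrix (Fin 2) (Fin 2) ℝ) (u w : ℝ × ℝ) : v₂ A (u - w) = v₂ A u - v₂ A w := by
  simp only [v₂, Prod.fst_sub, Prod.snd_sub]; ring

/-- Boosts of one plane commute, so only the term `connection A (bracket X Y) Z` of the curvature
tensor survives. -/
theorem K_eq (hA : A.det ≠ 0) : K A = 4 * (slope₁ A * slope₂ A) := by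
  rw [K, bilin, riemann]
  simp only [v₁_sub, v₂_sub, v₁_connection hA, v₂_connection hA]
  unfold slope₁ slope₂ bracket connectionForm
  rw [inv_one_zero, inv_one_one]
  have hden : bilin A (1, 0) (1, 0) * bilin A (0, 1) (0, 1) - bilin A (1, 0) (0, 1) ^ 2
      = -A.det ^ 2 := by
    rw [Matrix.det_fin_two]; simp only [bilin, v₁, v₂]; ring
  rw [hden]
  simp only [v₁, v₂]
  field_simp
  rw [Matrix.det_fin_two]
  ring

end Inverse

/-! ### The Hamiltonian system in light-cone coordinates -/

section Riccati

/-- The solution of `f'' = m n f` that linearizes the Riccati equation `E' = n E² - m`,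
`E 0 = e`, whose solution is `e * coneDen n m e⁻¹ / coneDen m n e`. -/
noncomputable def coneDen (m n e t : ℝ) : ℝ := gcos (m * n) t - n * e * gsin (m * n) t

@[simp] theorem coneDen_zero (m n e : ℝ) : coneDen m n e 0 = 1 := by simp [coneDen]

/-- When f = 1/e the two denominators form a closed linear system, φ' = -n e χ and χ' = -m f φ. -/
theorem hasDerivAt_coneDen (m n : ℝ) {e f : ℝ} (hef : e * f = 1) (t : ℝ) :
    HasDerivAt (coneDen m n e) (-(n * e * coneDen n m f t)) t := by
  refine ((hasDerivAt_gcos (m * n) t).sub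
    ((hasDerivAt_gsin (m * n) t).const_mul (n * e))).congr_deriv ?_
  rw [coneDen, mul_comm n m]
  linear_combination -(m * n * gsin (m * n) t) * hef

theorem continuous_coneDen (m n e : ℝ) : Continuous (coneDen m n e) :=
  (continuous_gcos _).sub (continuous_const.mul (continuous_gsin _))

/-- A light-cone coordinate of a geodesic. -/
noncomputable def coneCoord (m n e t : ℝ) : ℝ := e * gsin (m * n) t / coneDen m n e t

@[simp] theorem coneCoord_zero (m n e : ℝ) : coneCoord m n e 0 = 0 := by simp [coneCoord]

theorem hasDerivAt_coneCoord {m n e t : ℝ} (he : e ≠ 0) (h : coneDen m n e t ≠ 0) :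
    HasDerivAt (coneCoord m n e) (e / coneDen m n e t ^ 2) t := by
  refine (((hasDerivAt_gsin (m * n) t).const_mul e).div
    (hasDerivAt_coneDen m n (mul_inv_cancel₀ he) t) h).congr_deriv ?_
  congr 1
  have := gcos_sq (m * n) t
  rw [coneDen, coneDen, mul_comm n m]; field_simp
  linear_combination this

theorem one_add_coneCoord {m n e t : ℝ} (h : coneDen m n e t ≠ 0) :
    1 + n * coneCoord m n e t = gcos (m * n) t / coneDen m n e t := by
  rw [coneCoord]; field_simp; rw [coneDen, mul_comm n m]; ring

/-- The left-hand side is the coordinate y of the geodesic. -/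
theorem one_add_coneCoord_add {m n e f t : ℝ} (hef : e * f = 1) (h₁ : coneDen m n e t ≠ 0)
    (h₂ : coneDen n m f t ≠ 0) :
    1 + m * coneCoord n m f t + n * coneCoord m n e t =
      1 / (coneDen m n e t * coneDen n m f t) := by
  have := gcos_sq (m * n) t
  rw [one_add_coneCoord h₂, coneCoord]
  field_simp
  rw [coneDen, coneDen, mul_comm n m]
  linear_combination this - (m * n * gsin (m * n) t ^ 2) * hef

theorem pos_of_continuousOn_of_ne_zero {f : ℝ → ℝ} {T : ℝ} (hf : ContinuousOn f (Icc 0 T))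
    (h0 : 0 < f 0) (hne : ∀ t ∈ Icc 0 T, f t ≠ 0) : ∀ t ∈ Icc 0 T, 0 < f t := by
  intro t ht
  by_contra! hlt
  obtain ⟨s, hs, hs0⟩ := intermediate_value_Icc' ht.1 (hf.mono (Icc_subset_Icc_right ht.2))
    ⟨hlt, h0.le⟩
  exact hne s ⟨hs.1, hs.2.trans ht.2⟩ hs0

/-- As long as the geodesic exists, `gcos` does not vanish. -/
theorem gcos_pos_of_coneDen_pos {m n e f T : ℝ} (hef : e * f = 1)
    (h₁ : ∀ t ∈ Icc 0 T, 0 < coneDen m n e t) (h₂ : ∀ t ∈ Icc 0 T, 0 < coneDen n m f t) :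
    ∀ t ∈ Icc 0 T, 0 < gcos (m * n) t := by
  refine pos_of_continuousOn_of_ne_zero (continuous_gcos _).continuousOn (by simp) ?_
  intro t ht h0
  have h := mul_pos (h₁ t ht) (h₂ t ht)
  have hsq := gcos_sq (m * n) t
  rw [coneDen, coneDen, mul_comm n m, h0] at h
  rw [h0] at hsq
  -- At a zero of C the identity C² = 1 + mn S² gives mn S² = -1, so the product of the denominators
  -- would be negative.
  have : (0 - n * e * gsin (m * n) t) * (0 - m * f * gsin (m * n) t) = -1 := by
    linear_combination (m * n * gsin (m * n) t ^ 2) * hef - hsq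
  linarith

/-- The solutions of the geodesic equation in light-cone coordinates. -/
theorem cone_solution {m n e f T : ℝ} (he : 0 < e) (hef : e * f = 1) {y E F p r : ℝ → ℝ}
    (hy : ∀ t ∈ Icc 0 T, HasDerivWithinAt y (y t * (n * E t + m * F t)) (Icc 0 T) t)
    (hE : ∀ t ∈ Icc 0 T, HasDerivWithinAt E (n * E t ^ 2 - m * (E t * F t)) (Icc 0 T) t)
    (hF : ∀ t ∈ Icc 0 T, HasDerivWithinAt F (m * F t ^ 2 - n * (E t * F t)) (Icc 0 T) t)
    (hp : ∀ t ∈ Icc 0 T, HasDerivWithinAt p (y t * F t) (Icc 0 T) t)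
    (hr : ∀ t ∈ Icc 0 T, HasDerivWithinAt r (y t * E t) (Icc 0 T) t)
    (hy0 : y 0 = 1) (hE0 : E 0 = e) (hF0 : F 0 = f) (hp0 : p 0 = 0) (hr0 : r 0 = 0)
    (hypos : ∀ t ∈ Icc 0 T, 0 < y t) :
    ∀ t ∈ Icc 0 T, 0 < coneDen m n e t ∧ 0 < coneDen n m f t ∧
      p t = coneCoord n m f t ∧ r t = coneCoord m n e t := by
  have hfe : f * e = 1 := by rw [mul_comm, hef]
  have hf : 0 < f := pos_of_mul_pos_right (hef ▸ one_pos) he.le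
  have hφ (t : ℝ) := (hasDerivAt_coneDen m n hef t).hasDerivWithinAt (s := Icc 0 T)
  have hχ (t : ℝ) := (hasDerivAt_coneDen n m hfe t).hasDerivWithinAt (s := Icc 0 T)
  have hEF : ∀ t ∈ Icc 0 T, E t * F t = 1 := by
    intro t ht
    rw [eq_of_hasDerivWithinAt_zero (f := fun t => E t * F t) (T := T) (fun t ht =>
      ((hE t ht).mul (hF t ht)).congr_deriv (by ring_nf)) t ht, hE0, hF0, hef]
  have hEpos : ∀ t ∈ Icc 0 T, 0 < E t :=
    pos_of_continuousOn_of_ne_zero (fun t ht => (hE t ht).continuousWithinAt) (hE0 ▸ he)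
      fun t ht h0 => by simpa [h0] using hEF t ht
  -- The defect d = φE - eχ satisfies d' = nE d, while y/F has logarithmic derivative 2nE. So d² F /
  -- y is a first integral that vanishes at 0. This replaces an appeal to uniqueness for the
  -- differential equation.
  have hw : ∀ t ∈ Icc 0 T, coneDen m n e t * E t = e * coneDen n m f t := by
    intro t ht
    have key := eq_of_hasDerivWithinAt_zero
      (f := fun t => (coneDen m n e t * E t - e * coneDen n m f t) ^ 2 * F t / y t) (T := T)
      (fun t ht => ?_) t ht
    · have hF0 : F t ≠ 0 := fun h0 => by simpa [h0] using hEF t ht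
      simp only [coneDen_zero, hE0, mul_one, one_mul, sub_self, ne_eq, OfNat.ofNat_ne_zero,
        not_false_eq_true, zero_pow, zero_mul, zero_div, div_eq_zero_iff, mul_eq_zero,
        pow_eq_zero_iff, hF0, (hypos t ht).ne', or_false] at key
      linarith
    · refine ((((((hφ t).mul (hE t ht)).sub ((hχ t).const_mul e)).pow 2).mul (hF t ht)).div
        (hy t ht) (hypos t ht).ne').congr_deriv ?_
      have h1 := hEF t ht
      simp only [Pi.mul_apply, Pi.sub_apply, Pi.pow_apply]
      rw [div_eq_zero_iff]; left
      rw [h1]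
      set φ := coneDen m n e t
      set χ := coneDen n m f t
      linear_combination (2 * (φ * E t - e * χ) * F t * y t * m * φ) * hef +
        (φ * E t - e * χ) ^ 2 * n * y t * h1
  have hyφχ : ∀ t ∈ Icc 0 T, y t * (coneDen m n e t * coneDen n m f t) = 1 := by
    intro t ht
    rw [eq_of_hasDerivWithinAt_zero (f := fun t => y t * (coneDen m n e t * coneDen n m f t))
      (T := T) (fun t ht => ((hy t ht).mul ((hφ t).mul (hχ t))).congr_deriv ?_) t ht]
    · simp [hy0]
    · have h1 := hEF t ht
      have h2 := hw t ht
      simp only [Pi.mul_apply]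
      set φ := coneDen m n e t
      set χ := coneDen n m f t
      have h3 : χ = f * (φ * E t) := by rw [h2, ← mul_assoc, hfe, one_mul]
      rw [h3]
      linear_combination (m * y t * φ ^ 2 * f) * h1 -
        (y t * n * φ ^ 2 * f * E t ^ 2) * hef
  have hφpos : ∀ t ∈ Icc 0 T, 0 < coneDen m n e t :=
    pos_of_continuousOn_of_ne_zero (continuous_coneDen _ _ _).continuousOn (by simp)
      fun t ht h0 => by simpa [h0] using hyφχ t ht
  have hχpos : ∀ t ∈ Icc 0 T, 0 < coneDen n m f t := fun t ht =>
    pos_of_mul_pos_right (hw t ht ▸ mul_pos (hφpos t ht) (hEpos t ht)) he.le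
  intro t ht
  refine ⟨hφpos t ht, hχpos t ht, ?_, ?_⟩
  · refine sub_eq_zero.1 ((eq_of_hasDerivWithinAt_zero (f := fun t => p t - coneCoord n m f t)
      (T := T) (fun t ht => ((hp t ht).sub (hasDerivAt_coneCoord hf.ne'
        (hχpos t ht).ne').hasDerivWithinAt).congr_deriv ?_) t ht).trans (by simp [hp0]))
    have h1 := hEF t ht
    have h2 := hw t ht
    have h3 := hyφχ t ht
    have h4 := (hχpos t ht).ne'
    set φ := coneDen m n e t
    set χ := coneDen n m f t
    rw [sub_eq_zero, eq_div_iff (pow_ne_zero 2 h4)]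
    have h5 : F t * χ = φ * f := by
      linear_combination φ * f * h1 - F t * f * h2 - (F t * χ) * hef
    linear_combination y t * χ * h5 + f * h3
  · refine sub_eq_zero.1 ((eq_of_hasDerivWithinAt_zero (f := fun t => r t - coneCoord m n e t)
      (T := T) (fun t ht => ((hr t ht).sub (hasDerivAt_coneCoord he.ne'
        (hφpos t ht).ne').hasDerivWithinAt).congr_deriv ?_) t ht).trans (by simp [hr0]))
    have h2 := hw t ht
    have h3 := hyφχ t ht
    have h4 := (hφpos t ht).ne'
    rw [sub_eq_zero, eq_div_iff (pow_ne_zero 2 h4)]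
    linear_combination y t * coneDen m n e t * h2 + e * h3

end Riccati

/-! ### Hamiltonian trajectories and explicit geodesics -/

section Extremal

variable {A : Matrix (Fin 2) (Fin 2) ℝ}

theorem deriv_quadratic (a b c d s : ℝ) :
    deriv (fun s => (-(s * a + b) ^ 2 + (s * c + d) ^ 2) / 2) s =
      -((s * a + b) * a) + (s * c + d) * c := by
  have h1 := ((hasDerivAt_id' s).mul_const a).add_const b
  have h2 := ((hasDerivAt_id' s).mul_const c).add_const d
  exact (((h1.pow 2).neg.add (h2.pow 2)).div_const 2).congr_deriv (by push_cast; ring) |>.deriv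

theorem hamiltonianField_eq (A : Matrix (Fin 2) (Fin 2) ℝ) (z : (ℝ × ℝ) × (ℝ × ℝ)) :
    hamiltonianField A z =
      ((z.1.2 * (-(h₁ A z * A⁻¹ 0 0) + h₂ A z * A⁻¹ 0 1),
        z.1.2 * (-(h₁ A z * A⁻¹ 1 0) + h₂ A z * A⁻¹ 1 1)),
       (0, h₁ A z * (z.2.1 * A⁻¹ 0 0 + z.2.2 * A⁻¹ 1 0) -
          h₂ A z * (z.2.1 * A⁻¹ 0 1 + z.2.2 * A⁻¹ 1 1))) := by
  obtain ⟨⟨x, y⟩, ⟨p₁, p₂⟩⟩ := z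
  have e1 := deriv_quadratic (y * A⁻¹ 0 0) (p₂ * (y * A⁻¹ 1 0)) (y * A⁻¹ 0 1)
    (p₂ * (y * A⁻¹ 1 1)) p₁
  have e2 := deriv_quadratic (y * A⁻¹ 1 0) (p₁ * (y * A⁻¹ 0 0)) (y * A⁻¹ 1 1)
    (p₁ * (y * A⁻¹ 0 1)) p₂
  have e3 := deriv_quadratic (p₁ * A⁻¹ 0 0 + p₂ * A⁻¹ 1 0) 0 (p₁ * A⁻¹ 0 1 + p₂ * A⁻¹ 1 1) 0 y
  simp only [hamiltonianField, H, h₁, h₂, Y₁, Y₂, deriv_const, neg_zero, Prod.mk.injEq, true_and]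
  refine ⟨⟨e1.trans (by ring), ?_⟩, ?_⟩
  · rw [show (fun s => (-(p₁ * (y * A⁻¹ 0 0) + s * (y * A⁻¹ 1 0)) ^ 2 +
      (p₁ * (y * A⁻¹ 0 1) + s * (y * A⁻¹ 1 1)) ^ 2) / 2) =
      (fun s => (-(s * (y * A⁻¹ 1 0) + p₁ * (y * A⁻¹ 0 0)) ^ 2 +
        (s * (y * A⁻¹ 1 1) + p₁ * (y * A⁻¹ 0 1)) ^ 2) / 2) by ext; ring, e2]
    ring
  · rw [show (fun s => (-(p₁ * (s * A⁻¹ 0 0) + p₂ * (s * A⁻¹ 1 0)) ^ 2 +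
      (p₁ * (s * A⁻¹ 0 1) + p₂ * (s * A⁻¹ 1 1)) ^ 2) / 2) =
      (fun s => (-(s * (p₁ * A⁻¹ 0 0 + p₂ * A⁻¹ 1 0) + 0) ^ 2 +
        (s * (p₁ * A⁻¹ 0 1 + p₂ * A⁻¹ 1 1) + 0) ^ 2) / 2) by ext; ring, e3]
    ring

theorem hasDerivWithinAt_fst {E F : Type*} [NormedAddCommGroup E] [NormedSpace ℝ E]
    [NormedAddCommGroup F] [NormedSpace ℝ F] {f : ℝ → E × F} {f' : E × F} {s : Set ℝ} {t : ℝ}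
    (h : HasDerivWithinAt f f' s t) : HasDerivWithinAt (fun t => (f t).1) f'.1 s t :=
  (ContinuousLinearMap.fst ℝ E F).hasFDerivAt.comp_hasDerivWithinAt t h

theorem hasDerivWithinAt_snd {E F : Type*} [NormedAddCommGroup E] [NormedSpace ℝ E]
    [NormedAddCommGroup F] [NormedSpace ℝ F] {f : ℝ → E × F} {f' : E × F} {s : Set ℝ} {t : ℝ}
    (h : HasDerivWithinAt f f' s t) : HasDerivWithinAt (fun t => (f t).2) f'.2 s t :=
  (ContinuousLinearMap.snd ℝ E F).hasFDerivAt.comp_hasDerivWithinAt t h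

/-- A Hamiltonian trajectory, in light-cone coordinates. -/
theorem IsNormalExtremal.cone (hA : A.det ≠ 0) {ψ T : ℝ} {z : ℝ → (ℝ × ℝ) × (ℝ × ℝ)}
    (hz : IsNormalExtremal A ψ T z) :
    ∀ t ∈ Icc 0 T, 0 < coneDen (slope₁ A) (slope₂ A) (Real.exp ψ) t ∧
      0 < coneDen (slope₂ A) (slope₁ A) (Real.exp (-ψ)) t ∧
      -lam₁ A (z t).1 = coneCoord (slope₂ A) (slope₁ A) (Real.exp (-ψ)) t ∧
      lam₂ A (z t).1 = coneCoord (slope₁ A) (slope₂ A) (Real.exp ψ) t := by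
  have hode : ∀ t ∈ Icc 0 T, HasDerivWithinAt z _ (Icc 0 T) t := fun t ht =>
    (hz.ode t ht).congr_deriv (hamiltonianField_eq A (z t))
  have hx := fun t ht => hasDerivWithinAt_fst (hasDerivWithinAt_fst (hode t ht))
  have hy := fun t ht => hasDerivWithinAt_snd (hasDerivWithinAt_fst (hode t ht))
  have hp₁ := fun t ht => hasDerivWithinAt_fst (hasDerivWithinAt_snd (hode t ht))
  have hp₂ := fun t ht => hasDerivWithinAt_snd (hasDerivWithinAt_snd (hode t ht))
  simp only at hx hy hp₁ hp₂
  have hh₁ : ∀ t ∈ Icc 0 T, HasDerivWithinAt (fun t => h₁ A (z t)) _ (Icc 0 T) t := fun t ht =>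
    ((hp₁ t ht).mul ((hy t ht).mul_const (A⁻¹ 0 0))).add
      ((hp₂ t ht).mul ((hy t ht).mul_const (A⁻¹ 1 0)))
  have hh₂ : ∀ t ∈ Icc 0 T, HasDerivWithinAt (fun t => h₂ A (z t)) _ (Icc 0 T) t := fun t ht =>
    ((hp₁ t ht).mul ((hy t ht).mul_const (A⁻¹ 0 1))).add
      ((hp₂ t ht).mul ((hy t ht).mul_const (A⁻¹ 1 1)))
  have m1 := mul_inv_zero_zero hA
  have m2 := mul_inv_zero_one A
  have m3 := mul_inv_one_zero A
  have m4 := mul_inv_one_one hA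
  refine cone_solution (y := fun t => (z t).1.2) (E := fun t => h₂ A (z t) - h₁ A (z t))
    (F := fun t => -h₁ A (z t) - h₂ A (z t)) (Real.exp_pos ψ)
    (by rw [← Real.exp_add, add_neg_cancel, Real.exp_zero]) ?_ ?_ ?_ ?_ ?_ ?_ ?_ ?_ ?_ ?_ ?_
  · intro t ht
    refine (hy t ht).congr_deriv ?_
    unfold slope₁ slope₂; ring
  · intro t ht
    refine ((hh₂ t ht).sub (hh₁ t ht)).congr_deriv ?_
    simp only [slope₁, slope₂, h₁, h₂, Y₁, Y₂]; ring
  · intro t ht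
    refine ((hh₁ t ht).neg.sub (hh₂ t ht)).congr_deriv ?_
    simp only [slope₁, slope₂, h₁, h₂, Y₁, Y₂]; ring
  · intro t ht
    refine (((hx t ht).const_mul (A 1 0 - A 0 0)).add
      (((hy t ht).sub_const 1).const_mul (A 1 1 - A 0 1))).neg.congr_deriv ?_
    linear_combination (-h₁ A (z t) * (z t).1.2) * m1 + h₂ A (z t) * (z t).1.2 * m2 +
      h₁ A (z t) * (z t).1.2 * m3 - h₂ A (z t) * (z t).1.2 * m4
  · intro t ht
    refine (((hx t ht).const_mul (A 1 0 + A 0 0)).add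
      (((hy t ht).sub_const 1).const_mul (A 1 1 + A 0 1))).congr_deriv ?_
    linear_combination (-h₁ A (z t) * (z t).1.2) * m1 + h₂ A (z t) * (z t).1.2 * m2 -
      h₁ A (z t) * (z t).1.2 * m3 + h₂ A (z t) * (z t).1.2 * m4
  · simp [hz.start, Id]
  · simp only [hz.start_h₁, hz.start_h₂]
    rw [Real.cosh_eq, Real.sinh_eq]; ring
  · simp only [hz.start_h₁, hz.start_h₂]
    rw [Real.cosh_eq, Real.sinh_eq]; ring
  · simp [hz.start, lam₁_Id]
  · simp [hz.start, lam₂_Id]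
  · exact fun t ht => hz.mem t ht

/-- The geodesic with initial velocity of rapidity `ψ`, as long as it exists. -/
noncomputable def geodesic (A : Matrix (Fin 2) (Fin 2) ℝ) (ψ t : ℝ) : ℝ × ℝ :=
  ofCone A (coneCoord (slope₂ A) (slope₁ A) (Real.exp (-ψ)) t)
    (coneCoord (slope₁ A) (slope₂ A) (Real.exp ψ) t)

/-- The geodesic exists on `[0, T]`. -/
def GeodesicExists (A : Matrix (Fin 2) (Fin 2) ℝ) (ψ T : ℝ) : Prop :=
  ∀ t ∈ Icc 0 T, 0 < coneDen (slope₁ A) (slope₂ A) (Real.exp ψ) t ∧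
      0 < coneDen (slope₂ A) (slope₁ A) (Real.exp (-ψ)) t

theorem hasDerivAt_ofCone {p r : ℝ → ℝ} {p' r' t : ℝ} (hp : HasDerivAt p p' t)
    (hr : HasDerivAt r r' t) : HasDerivAt (fun t => ofCone A (p t) (r t))
      (((A⁻¹ 0 0 - A⁻¹ 0 1) * p' + (A⁻¹ 0 0 + A⁻¹ 0 1) * r') / 2,
        slope₁ A * p' + slope₂ A * r') t :=
  (((hp.const_mul _).add (hr.const_mul _)).div_const 2).prodMk
    (((hp.const_mul _).const_add 1).add (hr.const_mul _))

theorem exp_mul_exp_neg (ψ : ℝ) : Real.exp ψ * Real.exp (-ψ) = 1 := by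
  rw [← Real.exp_add, add_neg_cancel, Real.exp_zero]

theorem exp_neg_mul_exp (ψ : ℝ) : Real.exp (-ψ) * Real.exp ψ = 1 := by
  rw [mul_comm, exp_mul_exp_neg]

theorem GeodesicExists.exists_extremal (hA : A.det ≠ 0) {ψ T : ℝ} (h : GeodesicExists A ψ T) :
    ∃ z, IsNormalExtremal A ψ T z := by
  have m1 := mul_inv_zero_zero hA
  have m2 := mul_inv_zero_one A
  have m3 := mul_inv_one_zero A
  have m4 := mul_inv_one_one hA
  have hef := exp_mul_exp_neg ψ
  have hfe := exp_neg_mul_exp ψ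
  set e := Real.exp ψ
  set f := Real.exp (-ψ)
  set φ := coneDen (slope₁ A) (slope₂ A) e
  set χ := coneDen (slope₂ A) (slope₁ A) f
  have he : e ≠ 0 := left_ne_zero_of_mul_eq_one hef
  have hf : f ≠ 0 := right_ne_zero_of_mul_eq_one hef
  -- The covector is chosen so that h₂ - h₁ = y e χ² and -h₁ - h₂ = y f φ²; since y φχ = 1, these
  -- are eχ/φ and fφ/χ, the solutions of the Riccati equations.
  let z : ℝ → (ℝ × ℝ) × (ℝ × ℝ) := fun t => (geodesic A ψ t,
    (-((A 0 0 - A 1 0) * (e * χ t ^ 2) + (A 0 0 + A 1 0) * (f * φ t ^ 2)) / 2,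
     -((A 0 1 - A 1 1) * (e * χ t ^ 2) + (A 0 1 + A 1 1) * (f * φ t ^ 2)) / 2))
  have hsnd : ∀ t ∈ Icc 0 T, (z t).1.2 = 1 / (φ t * χ t) := fun t ht =>
    one_add_coneCoord_add hef (h t ht).1.ne' (h t ht).2.ne'
  have hh₁ : ∀ t, h₁ A (z t) = -(z t).1.2 * (e * χ t ^ 2 + f * φ t ^ 2) / 2 := by
    intro t
    simp only [h₁, Y₁, z]
    set y := (geodesic A ψ t).2
    linear_combination (-y * (e * χ t ^ 2 + f * φ t ^ 2) / 2) * m1 +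
      (y * (e * χ t ^ 2 - f * φ t ^ 2) / 2) * m3
  have hh₂ : ∀ t, h₂ A (z t) = (z t).1.2 * (e * χ t ^ 2 - f * φ t ^ 2) / 2 := by
    intro t
    simp only [h₂, Y₂, z]
    set y := (geodesic A ψ t).2
    linear_combination (-y * (e * χ t ^ 2 + f * φ t ^ 2) / 2) * m2 +
      (y * (e * χ t ^ 2 - f * φ t ^ 2) / 2) * m4
  refine ⟨z, ?_, ?_, ?_, ?_, ?_⟩
  · simp [z, geodesic, ofCone, Id]
  · rw [hh₁]
    simp [z, geodesic, ofCone, χ, φ, Real.cosh_eq, e, f]; ring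
  · rw [hh₂]
    simp [z, geodesic, ofCone, χ, φ, Real.sinh_eq, e, f]
  · intro t ht
    change 0 < (z t).1.2
    rw [hsnd t ht]
    exact one_div_pos.2 (mul_pos (h t ht).1 (h t ht).2)
  · intro t ht
    have hφ : HasDerivAt φ (-(slope₂ A * e * χ t)) t := hasDerivAt_coneDen _ _ hef t
    have hχ : HasDerivAt χ (-(slope₁ A * f * φ t)) t := hasDerivAt_coneDen _ _ hfe t
    have hE := (hχ.pow 2).const_mul e
    have hF := (hφ.pow 2).const_mul f
    have hp : HasDerivAt _ (f / χ t ^ 2) t := hasDerivAt_coneCoord hf (h t ht).2.ne'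
    have hr : HasDerivAt _ (e / φ t ^ 2) t := hasDerivAt_coneCoord he (h t ht).1.ne'
    have key := (hasDerivAt_ofCone (A := A) hp hr).prodMk
      (((((hE.const_mul (A 0 0 - A 1 0)).add (hF.const_mul (A 0 0 + A 1 0))).neg).div_const
        2).prodMk
      ((((hE.const_mul (A 0 1 - A 1 1)).add (hF.const_mul (A 0 1 + A 1 1))).neg).div_const 2))
    refine (HasDerivAt.congr_deriv (f := z) key ?_).hasDerivWithinAt
    have hφ0 : φ t ≠ 0 := (h t ht).1.ne'
    have hχ0 : χ t ≠ 0 := (h t ht).2.ne'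
    rw [hamiltonianField_eq, hh₁, hh₂, hsnd t ht]
    have m5 := inv_mul_one_zero A
    have m6 := inv_mul_one_one hA
    have hpα : (z t).2.1 * A⁻¹ 0 0 + (z t).2.2 * A⁻¹ 1 0 = -(e * χ t ^ 2 + f * φ t ^ 2) / 2 := by
      simp only [z]
      linear_combination (-(e * χ t ^ 2 + f * φ t ^ 2) / 2) * m1 +
        ((e * χ t ^ 2 - f * φ t ^ 2) / 2) * m3
    have hpβ : (z t).2.1 * A⁻¹ 0 1 + (z t).2.2 * A⁻¹ 1 1 = (e * χ t ^ 2 - f * φ t ^ 2) / 2 := by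
      simp only [z]
      linear_combination (-(e * χ t ^ 2 + f * φ t ^ 2) / 2) * m2 +
        ((e * χ t ^ 2 - f * φ t ^ 2) / 2) * m4
    rw [hpα, hpβ]
    refine Prod.ext (Prod.ext ?_ ?_) (Prod.ext ?_ ?_)
    · change ((A⁻¹ 0 0 - A⁻¹ 0 1) * (f / χ t ^ 2) + (A⁻¹ 0 0 + A⁻¹ 0 1) * (e / φ t ^ 2)) / 2 =
        1 / (φ t * χ t) * (-(-(1 / (φ t * χ t)) * (e * χ t ^ 2 + f * φ t ^ 2) / 2 * A⁻¹ 0 0) +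
          1 / (φ t * χ t) * (e * χ t ^ 2 - f * φ t ^ 2) / 2 * A⁻¹ 0 1)
      field_simp; ring
    · change slope₁ A * (f / χ t ^ 2) + slope₂ A * (e / φ t ^ 2) =
        1 / (φ t * χ t) * (-(-(1 / (φ t * χ t)) * (e * χ t ^ 2 + f * φ t ^ 2) / 2 * A⁻¹ 1 0) +
          1 / (φ t * χ t) * (e * χ t ^ 2 - f * φ t ^ 2) / 2 * A⁻¹ 1 1)
      unfold slope₁ slope₂
      field_simp; ring
    · unfold slope₁ slope₂
      push_cast
      linear_combination (φ t * χ t * e * f) * m5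
    · unfold slope₁ slope₂
      push_cast
      field_simp
      linear_combination (4 * φ t ^ 2 * χ t ^ 2 * e * f) * m6

end Extremal

/-! ### Surjectivity in light-cone coordinates -/

section Coordinates

/-- The ratio of the generalized tangents is monotone. -/
theorem gsin_div_gcos_le {κ s t : ℝ} (hC : ∀ r ∈ Icc 0 t, 0 < gcos κ r) (hs : 0 ≤ s)
    (hst : s ≤ t) : gsin κ s / gcos κ s ≤ gsin κ t / gcos κ t := by
  have hd : ∀ r ∈ Icc 0 t, HasDerivAt (fun r => gsin κ r / gcos κ r) (1 / gcos κ r ^ 2) r := by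
    intro r hr
    refine ((hasDerivAt_gsin κ r).div (hasDerivAt_gcos κ r) (hC r hr).ne').congr_deriv ?_
    congr 1
    linear_combination gcos_sq κ r
  have hmono : MonotoneOn (fun r => gsin κ r / gcos κ r) (Icc 0 t) := by
    refine monotoneOn_of_deriv_nonneg (convex_Icc 0 t)
      (fun r hr => (hd r hr).continuousAt.continuousWithinAt)
      (fun r hr => (hd r (interior_subset hr)).differentiableAt.differentiableWithinAt) ?_
    intro r hr
    rw [(hd r (interior_subset hr)).deriv]
    positivity
  exact hmono ⟨hs, hst⟩ ⟨hs.trans hst, le_rfl⟩ hst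

/-- Write φ = C (1 - n e S/C). Since S/C is increasing, positivity at the final time implies it
before, so existence of a geodesic needs checking only at its end point. -/
theorem coneDen_pos_of_le {m n e t : ℝ} (he : 0 < e) (hC : ∀ r ∈ Icc 0 t, 0 < gcos (m * n) r)
    (h : 0 < coneDen m n e t) : ∀ s ∈ Icc 0 t, 0 < coneDen m n e s := by
  intro s hs
  have hCs := hC s hs
  have hCt := hC t ⟨hs.1.trans hs.2, le_rfl⟩
  have hSs : 0 ≤ gsin (m * n) s := by
    rcases hs.1.eq_or_lt with h0 | h0
    · simp [← h0]
    · exact (gsin_pos (fun r hr => hC r ⟨hr.1, hr.2.trans hs.2⟩) h0).le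
  have hle := gsin_div_gcos_le hC hs.1 hs.2
  rw [coneDen] at h ⊢
  rcases le_or_gt n 0 with hn | hn
  · nlinarith [mul_nonneg (mul_nonneg (neg_nonneg.2 hn) he.le) hSs]
  · have h1 : n * e * (gsin (m * n) t / gcos (m * n) t) < 1 := by
      rw [← mul_div_assoc, div_lt_one hCt]; linarith
    have h2 := (mul_le_mul_of_nonneg_left hle (mul_pos hn he).le).trans_lt h1
    rw [← mul_div_assoc, div_lt_one hCs] at h2
    linarith

/-- Every point of the chronological future of the origin is joined to it by a geodesic. -/
theorem exists_coneCoord_eq {m n p r : ℝ} (hp : 0 < p) (hr : 0 < r) (hy : 0 < 1 + m * p + n * r)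
    (hmp : 0 < 1 + m * p) (hnr : 0 < 1 + n * r) :
    ∃ ψ t, 0 < t ∧ (∀ s ∈ Icc 0 t, 0 < coneDen m n (Real.exp ψ) s ∧
      0 < coneDen n m (Real.exp (-ψ)) s) ∧
      coneCoord n m (Real.exp (-ψ)) t = p ∧ coneCoord m n (Real.exp ψ) t = r := by
  set y := 1 + m * p + n * r with hydef
  -- The time is found from S² = pr/y. It exists because (1 + m p)(1 + n r) = y + mn pr makes 1 + mn
  -- S² positive. The rapidity is found from e² = r(1 + m p)/(p(1 + n r)), whence the half logarithm
  -- below.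
  have hσ : 0 < p * r / y := by positivity
  have hκ : 1 + m * n * √(p * r / y) ^ 2 = (1 + m * p) * (1 + n * r) / y := by
    rw [Real.sq_sqrt hσ.le]; field_simp; rw [hydef]; ring
  obtain ⟨t, ht, hS, hC⟩ := exists_gsin_eq (κ := m * n) (Real.sqrt_pos.2 hσ)
    (by rw [hκ]; positivity)
  have hSpos := gsin_pos hC ht
  have hCpos := hC t ⟨ht.le, le_rfl⟩
  have hS2 : gsin (m * n) t ^ 2 = p * r / y := by rw [hS, Real.sq_sqrt hσ.le]
  have hC2 : gcos (m * n) t ^ 2 = (1 + m * p) * (1 + n * r) / y := by rw [gcos_sq, hS, hκ]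
  have hR : 0 < r * (1 + m * p) / (p * (1 + n * r)) := by positivity
  have he2 : Real.exp (Real.log (r * (1 + m * p) / (p * (1 + n * r))) / 2) ^ 2 =
      r * (1 + m * p) / (p * (1 + n * r)) := by
    rw [← Real.exp_nat_mul]; push_cast; rw [mul_div_cancel₀ _ two_ne_zero, Real.exp_log hR]
  set ψ := Real.log (r * (1 + m * p) / (p * (1 + n * r))) / 2
  have he := Real.exp_pos ψ
  have hf := Real.exp_pos (-ψ)
  have hef := exp_mul_exp_neg ψ
  set e := Real.exp ψ
  set f := Real.exp (-ψ)
  have heS : e * gsin (m * n) t = r * gcos (m * n) t / (1 + n * r) := by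
    refine (sq_eq_sq₀ (by positivity) (by positivity)).1 ?_
    rw [mul_pow, div_pow, mul_pow, he2, hS2, hC2]; field_simp
  have hfS : f * gsin (m * n) t = p * gcos (m * n) t / (1 + m * p) := by
    refine (sq_eq_sq₀ (by positivity) (by positivity)).1 ?_
    have hf2 : f ^ 2 = (p * (1 + n * r)) / (r * (1 + m * p)) := by
      rw [← inv_div, ← he2, ← inv_pow, eq_inv_of_mul_eq_one_right hef]
    rw [mul_pow, div_pow, mul_pow, hf2, hS2, hC2]; field_simp
  have hφ : coneDen m n e t = gcos (m * n) t / (1 + n * r) := by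
    rw [coneDen, mul_assoc, heS]; field_simp; ring
  have hχ : coneDen n m f t = gcos (m * n) t / (1 + m * p) := by
    rw [coneDen, mul_assoc, mul_comm n m, hfS]; field_simp; ring
  refine ⟨ψ, t, ht, fun s hs => ⟨coneDen_pos_of_le he hC (by rw [hφ]; positivity) s hs,
    coneDen_pos_of_le hf (by rwa [mul_comm n m]) (by rw [hχ]; positivity) s hs⟩, ?_, ?_⟩
  · rw [coneCoord, mul_comm n m, hfS, hχ, div_div_div_cancel_right₀ hmp.ne', mul_div_assoc,
      div_self hCpos.ne', mul_one]
  · rw [coneCoord, heS, hφ, div_div_div_cancel_right₀ hnr.ne', mul_div_assoc, div_self hCpos.ne',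
      mul_one]

end Coordinates

/-! ### The exponential mapping and its invariants -/

section Exponential

variable {A : Matrix (Fin 2) (Fin 2) ℝ}

theorem mem_N_iff (hA : A.det ≠ 0) {ψ t : ℝ} : (ψ, t) ∈ N A ↔ 0 < t ∧ GeodesicExists A ψ t := by
  constructor
  · rintro ⟨ht, z, hz⟩
    exact ⟨ht, fun s hs => ⟨(hz.cone hA s hs).1, (hz.cone hA s hs).2.1⟩⟩
  · rintro ⟨ht, h⟩
    exact ⟨ht, h.exists_extremal hA⟩

/-- `Exp` uses a chosen trajectory, but `IsNormalExtremal.cone` determines the light-cone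
coordinates of every trajectory, so the choice does not matter. -/
theorem Exp_eq (hA : A.det ≠ 0) {ψ t : ℝ} (ht : 0 ≤ t) (h : GeodesicExists A ψ t) :
    Exp A (ψ, t) = geodesic A ψ t := by
  have hex := h.exists_extremal hA
  have hz := hex.choose_spec.cone hA t ⟨ht, le_rfl⟩
  rw [Exp, dif_pos hex, ← ofCone_lam hA (hex.choose t).1, hz.2.2.1, hz.2.2.2, geodesic]

theorem GeodesicExists.mono {ψ s t : ℝ} (h : GeodesicExists A ψ t) (hst : s ≤ t) :
    GeodesicExists A ψ s := fun r hr => h r ⟨hr.1, hr.2.trans hst⟩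

/-- The chronological future of the identity (for `K < 0`, the part covered by geodesics). -/
def future (A : Matrix (Fin 2) (Fin 2) ℝ) : Set (ℝ × ℝ) :=
  {q | 0 < -lam₁ A q ∧ 0 < lam₂ A q ∧ 0 < q.2 ∧ 0 < 1 + slope₁ A * -lam₁ A q ∧
    0 < 1 + slope₂ A * lam₂ A q}

/-- The two-point invariant of `Id` and `q`. -/
noncomputable def sigma (A : Matrix (Fin 2) (Fin 2) ℝ) (q : ℝ × ℝ) : ℝ :=
  -lam₁ A q * lam₂ A q / q.2

/-- A first integral of the geodesics starting at `Id`. -/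
noncomputable def ratio (A : Matrix (Fin 2) (Fin 2) ℝ) (q : ℝ × ℝ) : ℝ :=
  lam₂ A q * (1 + slope₁ A * -lam₁ A q) / (-lam₁ A q * (1 + slope₂ A * lam₂ A q))

/-- The Lorentzian distance from `Id` to `q`. -/
noncomputable def lorentzDist (A : Matrix (Fin 2) (Fin 2) ℝ) (q : ℝ × ℝ) : ℝ :=
  garcsin (slope₁ A * slope₂ A) √(sigma A q)

theorem GeodesicExists.gcos_pos {ψ t : ℝ} (h : GeodesicExists A ψ t) :
    ∀ s ∈ Icc 0 t, 0 < gcos (slope₁ A * slope₂ A) s :=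
  gcos_pos_of_coneDen_pos (exp_mul_exp_neg ψ) (fun s hs => (h s hs).1) fun s hs => (h s hs).2

theorem GeodesicExists.snd {ψ t : ℝ} (h : GeodesicExists A ψ t) (ht : 0 ≤ t) :
    (geodesic A ψ t).2 = 1 / (coneDen (slope₁ A) (slope₂ A) (Real.exp ψ) t *
      coneDen (slope₂ A) (slope₁ A) (Real.exp (-ψ)) t) :=
  one_add_coneCoord_add (exp_mul_exp_neg ψ) (h t ⟨ht, le_rfl⟩).1.ne' (h t ⟨ht, le_rfl⟩).2.ne'

/-- Substitute p = f S/χ, r = e S/φ, y = 1/(φχ), 1 + m p = C/χ and 1 + n r = C/φ: the denominators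
cancel in both invariants. -/
theorem GeodesicExists.mem_future (hA : A.det ≠ 0) {ψ t : ℝ} (h : GeodesicExists A ψ t)
    (ht : 0 < t) : geodesic A ψ t ∈ future A ∧
      sigma A (geodesic A ψ t) = gsin (slope₁ A * slope₂ A) t ^ 2 ∧
      ratio A (geodesic A ψ t) = Real.exp ψ ^ 2 := by
  have hS := gsin_pos h.gcos_pos ht
  have hC := h.gcos_pos t ⟨ht.le, le_rfl⟩
  have hy := h.snd ht.le
  have hef := exp_mul_exp_neg ψ
  obtain ⟨hφ, hχ⟩ := h t ⟨ht.le, le_rfl⟩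
  have h1 := one_add_coneCoord hφ.ne'
  have h2 := one_add_coneCoord hχ.ne'
  have he := Real.exp_pos ψ
  have hf := Real.exp_pos (-ψ)
  rw [future, sigma, ratio, mem_ofPred_eq, hy]
  simp only [geodesic, lam₁_ofCone hA, lam₂_ofCone hA, neg_neg]
  rw [h1, h2]
  rw [mul_comm (slope₂ A) (slope₁ A)] at h2 ⊢
  simp only [coneCoord, mul_comm (slope₂ A) (slope₁ A)]
  set e := Real.exp ψ
  set f := Real.exp (-ψ)
  refine ⟨⟨by positivity, by positivity, by positivity, by positivity, by positivity⟩, ?_, ?_⟩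
  · field_simp
    rw [mul_comm f e, hef]
  · field_simp
    exact hef.symm

theorem lorentzDist_geodesic (hA : A.det ≠ 0) {ψ t : ℝ} (h : GeodesicExists A ψ t) (ht : 0 < t) :
    lorentzDist A (geodesic A ψ t) = t := by
  rw [lorentzDist, (h.mem_future hA ht).2.1, Real.sqrt_sq (gsin_pos h.gcos_pos ht).le,
    garcsin_gsin ht.le h.gcos_pos]

theorem exists_geodesic (hA : A.det ≠ 0) {q : ℝ × ℝ} (hq : q ∈ future A) :
    ∃ ψ t, 0 < t ∧ GeodesicExists A ψ t ∧ geodesic A ψ t = q := by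
  obtain ⟨h1, h2, h3, h4, h5⟩ := hq
  rw [snd_eq_cone hA] at h3
  obtain ⟨ψ, t, ht, hex, hp, hr⟩ := exists_coneCoord_eq h1 h2 h3 h4 h5
  exact ⟨ψ, t, ht, hex, by rw [geodesic, hp, hr, ofCone_lam hA]⟩

/-- Injectivity holds because `lorentzDist` reads off t and `ratio` reads off ψ; surjectivity is
`exists_geodesic`. -/
theorem bijOn_Exp_future (hA : A.det ≠ 0) : BijOn (Exp A) (N A) (future A) := by
  refine ⟨?_, ?_, ?_⟩
  · rintro ⟨ψ, t⟩ hN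
    obtain ⟨ht, h⟩ := (mem_N_iff hA).1 hN
    rw [Exp_eq hA ht.le h]
    exact (h.mem_future hA ht).1
  · rintro ⟨ψ, t⟩ hN ⟨ψ', t'⟩ hN' heq
    obtain ⟨ht, h⟩ := (mem_N_iff hA).1 hN
    obtain ⟨ht', h'⟩ := (mem_N_iff hA).1 hN'
    rw [Exp_eq hA ht.le h, Exp_eq hA ht'.le h'] at heq
    have h1 := lorentzDist_geodesic hA h ht
    have h2 := (h.mem_future hA ht).2.2
    rw [heq, lorentzDist_geodesic hA h' ht'] at h1
    rw [heq, (h'.mem_future hA ht').2.2, sq_eq_sq₀ (Real.exp_pos _).le (Real.exp_pos _).le,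
      Real.exp_eq_exp] at h2
    rw [h1, h2]
  · intro q hq
    obtain ⟨ψ, t, ht, h, rfl⟩ := exists_geodesic hA hq
    exact ⟨(ψ, t), (mem_N_iff hA).2 ⟨ht, h⟩, Exp_eq hA ht.le h⟩

/-- A point of the future is determined by its distance to `Id` and the first integral `ratio`. -/
theorem eq_geodesic (hA : A.det ≠ 0) {q : ℝ × ℝ} (hq : q ∈ future A) {ψ t : ℝ}
    (hd : lorentzDist A q = t) (hr : ratio A q = Real.exp ψ ^ 2) : q = geodesic A ψ t := by
  obtain ⟨ψ', t', ht', h', rfl⟩ := exists_geodesic hA hq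
  rw [lorentzDist_geodesic hA h' ht'] at hd
  rw [(h'.mem_future hA ht').2.2, sq_eq_sq₀ (Real.exp_pos _).le (Real.exp_pos _).le,
    Real.exp_eq_exp] at hr
  rw [hd, hr]

end Exponential

/-! ### Absolutely continuous functions along Lipschitz curves -/

section Calculus

/-- The composition of a `C¹` function with a Lipschitz curve is absolutely continuous. -/
theorem absolutelyContinuous_comp {E : Type*} [NormedAddCommGroup E] [NormedSpace ℝ E]
    {q : ℝ → E} {C : NNReal} {a b : ℝ}
    (hab : a ≤ b) (hq : LipschitzOnWith C q (Icc a b)) {g : E → ℝ}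
    (hg : ∀ t ∈ Icc a b, ContDiffAt ℝ 1 g (q t)) :
    AbsolutelyContinuousOnInterval (fun t => g (q t)) a b := by
  have hloc : LocallyLipschitzOn (Icc a b) (fun t => g (q t)) := by
    intro t ht
    obtain ⟨K, U, hU, hK⟩ := (hg t ht).exists_lipschitzOnWith
    refine ⟨K * C, q ⁻¹' U ∩ Icc a b, ?_, ?_⟩
    · exact Filter.inter_mem ((hq.continuousOn t ht).preimage_mem_nhdsWithin hU)
        self_mem_nhdsWithin
    · exact hK.comp (hq.mono inter_subset_right) fun s hs => hs.1
  obtain ⟨K, hK⟩ := hloc.exists_lipschitzOnWith_of_compact isCompact_Icc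
  exact LipschitzOnWith.absolutelyContinuousOnInterval (K := K) (by rwa [uIcc_of_le hab])

theorem integral_le_sub_of_absolutelyContinuous {f g : ℝ → ℝ} {a b : ℝ} (hab : a ≤ b)
    (hf : AbsolutelyContinuousOnInterval f a b) (hg : IntervalIntegrable g volume a b)
    (h : ∀ᵐ t, t ∈ Icc a b → ∃ f', HasDerivAt f f' t ∧ g t ≤ f') :
    ∫ t in a..b, g t ≤ f b - f a := by
  rw [← hf.integral_deriv_eq_sub]
  refine intervalIntegral.integral_mono_ae_restrict hab hg hf.intervalIntegrable_deriv ?_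
  rw [Filter.EventuallyLE, ae_restrict_iff' measurableSet_Icc]
  filter_upwards [h] with t ht hmem
  obtain ⟨f', hf', hle⟩ := ht hmem
  rwa [hf'.deriv]

theorem le_of_absolutelyContinuous {f : ℝ → ℝ} {a b : ℝ} (hab : a ≤ b)
    (hf : AbsolutelyContinuousOnInterval f a b)
    (h : ∀ᵐ t, t ∈ Icc a b → ∃ f', HasDerivAt f f' t ∧ 0 ≤ f') : f a ≤ f b := by
  have := integral_le_sub_of_absolutelyContinuous (g := fun _ => 0) hab hf
    intervalIntegrable_const h
  simpa using this

theorem contDiff_neg_lam₁ (A : Matrix (Fin 2) (Fin 2) ℝ) :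
    ContDiff ℝ 1 fun q => -lam₁ A q := by
  unfold lam₁; fun_prop

theorem contDiff_lam₂ (A : Matrix (Fin 2) (Fin 2) ℝ) : ContDiff ℝ 1 (lam₂ A) := by
  unfold lam₂; fun_prop

end Calculus

/-! ### Causal curves in light-cone coordinates -/

section CausalCurves

variable {A : Matrix (Fin 2) (Fin 2) ℝ}

theorem hasDerivAt_lam₁ {q : ℝ → ℝ × ℝ} {t : ℝ} (h : DifferentiableAt ℝ q t) (hy : 0 < (q t).2) :
    HasDerivAt (fun t => -lam₁ A (q t))
      ((q t).2 * (v₁ A (velocity q t) - v₂ A (velocity q t))) t := by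
  have h1 : HasDerivAt (fun t => (q t).1) (deriv q t).1 t :=
    (ContinuousLinearMap.fst ℝ ℝ ℝ).hasFDerivAt.comp_hasDerivAt t h.hasDerivAt
  have h2 : HasDerivAt (fun t => (q t).2) (deriv q t).2 t :=
    (ContinuousLinearMap.snd ℝ ℝ ℝ).hasFDerivAt.comp_hasDerivAt t h.hasDerivAt
  refine ((h1.const_mul (A 1 0 - A 0 0)).add
      ((h2.sub_const 1).const_mul (A 1 1 - A 0 1))).neg.congr_deriv ?_
  simp only [velocity, v₁, v₂]
  field_simp
  ring

theorem hasDerivAt_lam₂ {q : ℝ → ℝ × ℝ} {t : ℝ} (h : DifferentiableAt ℝ q t) (hy : 0 < (q t).2) :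
    HasDerivAt (fun t => lam₂ A (q t))
      ((q t).2 * (v₁ A (velocity q t) + v₂ A (velocity q t))) t := by
  have h1 : HasDerivAt (fun t => (q t).1) (deriv q t).1 t :=
    (ContinuousLinearMap.fst ℝ ℝ ℝ).hasFDerivAt.comp_hasDerivAt t h.hasDerivAt
  have h2 : HasDerivAt (fun t => (q t).2) (deriv q t).2 t :=
    (ContinuousLinearMap.snd ℝ ℝ ℝ).hasFDerivAt.comp_hasDerivAt t h.hasDerivAt
  refine ((h1.const_mul (A 1 0 + A 0 0)).add
      ((h2.sub_const 1).const_mul (A 1 1 + A 0 1))).congr_deriv ?_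
  simp only [velocity, v₁, v₂]
  field_simp
  ring

/-- The form of the velocity in light-cone coordinates. -/
theorem form_velocity_eq {q : ℝ → ℝ × ℝ} {t p' r' : ℝ} (h : DifferentiableAt ℝ q t)
    (hy : 0 < (q t).2) (hp : HasDerivAt (fun t => -lam₁ A (q t)) p' t)
    (hr : HasDerivAt (fun t => lam₂ A (q t)) r' t) :
    form A (velocity q t) = -(p' * r') / (q t).2 ^ 2 ∧
      v₁ A (velocity q t) = (p' + r') / (2 * (q t).2) := by
  rw [hp.unique (hasDerivAt_lam₁ h hy), hr.unique (hasDerivAt_lam₂ h hy), form]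
  constructor <;> field_simp <;> ring

/-- The derivatives of the light-cone coordinates along a causal curve. -/
theorem IsCausalCurve.ae_deriv (hA : A.det ≠ 0) {q₀ q₁ : ℝ × ℝ} {T : ℝ} {q : ℝ → ℝ × ℝ}
    (hq : IsCausalCurve A q₀ q₁ T q) :
    ∀ᵐ t, t ∈ Icc 0 T → ∃ p' r', HasDerivAt (fun t => -lam₁ A (q t)) p' t ∧
      HasDerivAt (fun t => lam₂ A (q t)) r' t ∧ 0 ≤ p' ∧ 0 ≤ r' ∧
      p' * r' = (q t).2 ^ 2 * |form A (velocity q t)| := by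
  filter_upwards [(ae_restrict_iff' measurableSet_Icc).1 hq.causal] with t ht hmem
  obtain ⟨hd, hform, hor⟩ := ht hmem
  have hy : 0 < (q t).2 := hq.mem t hmem
  rw [bilin_Y₁ hA] at hor
  have habs : |form A (velocity q t)| = -form A (velocity q t) := abs_of_nonpos hform
  rw [habs]
  rw [form] at hform
  have h1 : |v₂ A (velocity q t)| ≤ v₁ A (velocity q t) :=
    abs_le_of_sq_le_sq (by linarith) (by linarith)
  rw [abs_le] at h1
  refine ⟨_, _, hasDerivAt_lam₁ hd hy, hasDerivAt_lam₂ hd hy, mul_nonneg hy.le (by linarith),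
    mul_nonneg hy.le (by linarith), ?_⟩
  rw [form]; ring

/-- Future directed causal vectors satisfy |v₂| ≤ v₁, and p' = y (v₁ - v₂). -/
theorem IsCausalCurve.monotone_lam₁ (hA : A.det ≠ 0) {q₀ q₁ : ℝ × ℝ} {T : ℝ} {q : ℝ → ℝ × ℝ}
    (hq : IsCausalCurve A q₀ q₁ T q) : MonotoneOn (fun t => -lam₁ A (q t)) (Icc 0 T) := by
  intro s hs t ht hst
  obtain ⟨C, hC⟩ := hq.lipschitz
  have hsub : Icc s t ⊆ Icc 0 T := Icc_subset_Icc hs.1 ht.2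
  refine le_of_absolutelyContinuous (f := fun t => -lam₁ A (q t)) hst
    (absolutelyContinuous_comp (g := fun q => -lam₁ A q) hst (hC.mono hsub)
      fun _ _ => (contDiff_neg_lam₁ A).contDiffAt) ?_
  filter_upwards [hq.ae_deriv hA] with r hr hmem
  obtain ⟨p', r', h1, -, h2, -⟩ := hr (hsub hmem)
  exact ⟨p', h1, h2⟩

theorem IsCausalCurve.monotone_lam₂ (hA : A.det ≠ 0) {q₀ q₁ : ℝ × ℝ} {T : ℝ} {q : ℝ → ℝ × ℝ}
    (hq : IsCausalCurve A q₀ q₁ T q) : MonotoneOn (fun t => lam₂ A (q t)) (Icc 0 T) := by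
  intro s hs t ht hst
  obtain ⟨C, hC⟩ := hq.lipschitz
  have hsub : Icc s t ⊆ Icc 0 T := Icc_subset_Icc hs.1 ht.2
  refine le_of_absolutelyContinuous (f := fun t => lam₂ A (q t)) hst
    (absolutelyContinuous_comp (g := lam₂ A) hst (hC.mono hsub)
      fun _ _ => (contDiff_lam₂ A).contDiffAt) ?_
  filter_upwards [hq.ae_deriv hA] with r hr hmem
  obtain ⟨p', r', -, h1, -, h2, -⟩ := hr (hsub hmem)
  exact ⟨r', h1, h2⟩

theorem IsCausalCurve.lam₁_nonneg (hA : A.det ≠ 0) {q₁ : ℝ × ℝ} {T : ℝ} {q : ℝ → ℝ × ℝ}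
    (hq : IsCausalCurve A Id q₁ T q) {t : ℝ} (ht : t ∈ Icc 0 T) : 0 ≤ -lam₁ A (q t) := by
  have := hq.monotone_lam₁ hA ⟨le_rfl, hq.nonneg⟩ ht ht.1
  simpa [hq.start, lam₁_Id] using this

theorem IsCausalCurve.lam₂_nonneg (hA : A.det ≠ 0) {q₁ : ℝ × ℝ} {T : ℝ} {q : ℝ → ℝ × ℝ}
    (hq : IsCausalCurve A Id q₁ T q) {t : ℝ} (ht : t ∈ Icc 0 T) : 0 ≤ lam₂ A (q t) := by
  have := hq.monotone_lam₂ hA ⟨le_rfl, hq.nonneg⟩ ht ht.1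
  simpa [hq.start, lam₂_Id] using this

/-- An affine function positive at both ends of an interval is positive inside. Along a causal curve
this carries the conditions of `future` back from the end point. -/
theorem one_add_mul_pos {m p p₁ : ℝ} (hp : 0 ≤ p) (hle : p ≤ p₁) (h : 0 < 1 + m * p₁) :
    0 < 1 + m * p := by
  rcases le_or_gt 0 m with hm | hm
  · positivity
  · nlinarith

/-- A causal curve that ends in the future of `Id` runs in it once it has left the light cone. -/
theorem IsCausalCurve.mem_future (hA : A.det ≠ 0) {q₁ : ℝ × ℝ} {T : ℝ} {q : ℝ → ℝ × ℝ}
    (hq : IsCausalCurve A Id q₁ T q) (hq₁ : q₁ ∈ future A) {t : ℝ} (ht : t ∈ Icc 0 T)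
    (h : -lam₁ A (q t) * lam₂ A (q t) ≠ 0) : q t ∈ future A := by
  have hT : T ∈ Icc 0 T := ⟨hq.nonneg, le_rfl⟩
  obtain ⟨-, -, -, h4, h5⟩ := hq₁
  have hp := hq.monotone_lam₁ hA ht hT ht.2
  have hr := hq.monotone_lam₂ hA ht hT ht.2
  simp only [hq.finish] at hp hr
  have hp0 := hq.lam₁_nonneg hA ht
  have hr0 := hq.lam₂_nonneg hA ht
  exact ⟨hp0.lt_of_ne' (left_ne_zero_of_mul h), hr0.lt_of_ne' (right_ne_zero_of_mul h), hq.mem t ht,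
    one_add_mul_pos hp0 hp h4, one_add_mul_pos hr0 hr h5⟩

/-- If a light-cone coordinate vanishes at time `s`, the curve is lightlike up to time `s`. -/
theorem IsCausalCurve.ae_form_eq_zero (hA : A.det ≠ 0) {q₁ : ℝ × ℝ} {T : ℝ} {q : ℝ → ℝ × ℝ}
    (hq : IsCausalCurve A Id q₁ T q) {s : ℝ} (hs : s ∈ Icc 0 T)
    (h : -lam₁ A (q s) * lam₂ A (q s) = 0) :
    ∀ᵐ t, t ∈ Ioo 0 s → form A (velocity q t) = 0 := by
  filter_upwards [hq.ae_deriv hA] with t ht hmem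
  have hmem' : t ∈ Icc 0 T := ⟨hmem.1.le, hmem.2.le.trans hs.2⟩
  obtain ⟨p', r', hp, hr, -, -, heq⟩ := ht hmem'
  have hzero : p' * r' = 0 := by
    -- A nonnegative nondecreasing coordinate that vanishes at s vanishes on all of [0, s], so its
    -- derivative is 0 there.
    have hnhds : Ioo 0 s ∈ nhds t := Ioo_mem_nhds hmem.1 hmem.2
    rcases mul_eq_zero.1 h with h0 | h0
    · have : (fun t => -lam₁ A (q t)) =ᶠ[nhds t] fun _ => 0 := by
        filter_upwards [hnhds] with r hr
        have hr' : r ∈ Icc 0 T := ⟨hr.1.le, hr.2.le.trans hs.2⟩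
        exact le_antisymm (h0 ▸ hq.monotone_lam₁ hA hr' hs hr.2.le) (hq.lam₁_nonneg hA hr')
      rw [hp.unique ((hasDerivAt_const t (0 : ℝ)).congr_of_eventuallyEq this), zero_mul]
    · have : (fun t => lam₂ A (q t)) =ᶠ[nhds t] fun _ => 0 := by
        filter_upwards [hnhds] with r hr
        have hr' : r ∈ Icc 0 T := ⟨hr.1.le, hr.2.le.trans hs.2⟩
        exact le_antisymm (h0 ▸ hq.monotone_lam₂ hA hr' hs hr.2.le) (hq.lam₂_nonneg hA hr')
      rw [hr.unique ((hasDerivAt_const t (0 : ℝ)).congr_of_eventuallyEq this), mul_zero]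
  have hy : (q t).2 ≠ 0 := (hq.mem t hmem').ne'
  rw [hzero, eq_comm, mul_eq_zero, abs_eq_zero] at heq
  exact heq.resolve_left (pow_ne_zero 2 hy)

end CausalCurves

/-! ### Derivatives of the distance and of the first integral -/

section Distance

variable {A : Matrix (Fin 2) (Fin 2) ℝ}

theorem one_add_sigma (hA : A.det ≠ 0) {q : ℝ × ℝ} (hy : q.2 ≠ 0) :
    1 + slope₁ A * slope₂ A * sigma A q =
      (1 + slope₁ A * -lam₁ A q) * (1 + slope₂ A * lam₂ A q) / q.2 := by
  have h := snd_eq_cone hA q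
  rw [sigma]
  field_simp
  linear_combination h

theorem sigma_pos {q : ℝ × ℝ} (hq : q ∈ future A) : 0 < sigma A q :=
  div_pos (mul_pos hq.1 hq.2.1) hq.2.2.1

theorem one_add_sigma_pos (hA : A.det ≠ 0) {q : ℝ × ℝ} (hq : q ∈ future A) :
    0 < 1 + slope₁ A * slope₂ A * √(sigma A q) ^ 2 := by
  rw [Real.sq_sqrt (sigma_pos hq).le, one_add_sigma hA hq.2.2.1.ne']
  exact div_pos (mul_pos hq.2.2.2.1 hq.2.2.2.2) hq.2.2.1

theorem contDiffAt_lorentzDist (hA : A.det ≠ 0) {q : ℝ × ℝ} (hq : q ∈ future A) :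
    ContDiffAt ℝ 1 (lorentzDist A) q := by
  refine (contDiffAt_garcsin (one_add_sigma_pos hA hq)).comp q ?_
  refine ContDiffAt.sqrt ?_ (sigma_pos hq).ne'
  exact ContDiffAt.div ((contDiff_neg_lam₁ A).mul (contDiff_lam₂ A)).contDiffAt contDiffAt_snd
    hq.2.2.1.ne'

theorem contDiffAt_ratio {q : ℝ × ℝ} (hq : q ∈ future A) : ContDiffAt ℝ 1 (ratio A) q := by
  have h1 := contDiff_neg_lam₁ A
  have h2 := contDiff_lam₂ A
  refine ContDiffAt.div ?_ ?_ (mul_pos hq.1 hq.2.2.2.2).ne'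
  · exact (h2.mul (contDiff_const.add (contDiff_const.mul h1))).contDiffAt
  · exact (h1.mul (contDiff_const.add (contDiff_const.mul h2))).contDiffAt

theorem lorentzDist_pos (hA : A.det ≠ 0) {q : ℝ × ℝ} (hq : q ∈ future A) :
    0 < lorentzDist A q := by
  obtain ⟨ψ, t, ht, h, rfl⟩ := exists_geodesic hA hq
  rwa [lorentzDist_geodesic hA h ht]

/-- With X = r(1 + n r) and Y = p(1 + m p) the numerator is r'Y - p'X, which vanishes exactly in the
equality case of the estimate for `lorentzDist`. -/
theorem hasDerivAt_ratio {q : ℝ → ℝ × ℝ} {t p' r' : ℝ} (hq : q t ∈ future A)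
    (hp : HasDerivAt (fun t => -lam₁ A (q t)) p' t)
    (hr : HasDerivAt (fun t => lam₂ A (q t)) r' t) :
    HasDerivAt (fun t => ratio A (q t))
      ((r' * (-lam₁ A (q t) * (1 + slope₁ A * -lam₁ A (q t))) -
        p' * (lam₂ A (q t) * (1 + slope₂ A * lam₂ A (q t)))) /
          (-lam₁ A (q t) * (1 + slope₂ A * lam₂ A (q t))) ^ 2) t := by
  refine ((hr.mul ((hp.const_mul (slope₁ A)).const_add 1)).div
    (hp.mul ((hr.const_mul (slope₂ A)).const_add 1)) (mul_pos hq.1 hq.2.2.2.2).ne').congr_deriv ?_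
  simp only [Pi.mul_apply]
  congr 1
  ring

/-- The derivative is (p'X + r'Y)/(2y√(XY)) with X = r(1 + n r) and Y = p(1 + m p), a form to which
the inequality of means applies, since p'r' = y² |g| on causal curves. -/
theorem hasDerivAt_lorentzDist (hA : A.det ≠ 0) {q : ℝ → ℝ × ℝ} {t p' r' : ℝ}
    (hq : q t ∈ future A) (hp : HasDerivAt (fun t => -lam₁ A (q t)) p' t)
    (hr : HasDerivAt (fun t => lam₂ A (q t)) r' t) :
    HasDerivAt (fun t => lorentzDist A (q t))
      ((p' * (lam₂ A (q t) * (1 + slope₂ A * lam₂ A (q t))) +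
        r' * (-lam₁ A (q t) * (1 + slope₁ A * -lam₁ A (q t)))) /
          (2 * (q t).2 * √((lam₂ A (q t) * (1 + slope₂ A * lam₂ A (q t))) *
            (-lam₁ A (q t) * (1 + slope₁ A * -lam₁ A (q t)))))) t := by
  have hy : HasDerivAt (fun t => (q t).2) (slope₁ A * p' + slope₂ A * r') t := by
    rw [funext fun t => snd_eq_cone hA (q t)]
    exact ((hp.const_mul _).const_add 1).add (hr.const_mul _)
  have hσ : HasDerivAt (fun t => sigma A (q t)) _ t := (hp.mul hr).div hy hq.2.2.1.ne'
  refine ((hasDerivAt_garcsin (one_add_sigma_pos hA hq)).comp t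
    (hσ.sqrt (sigma_pos hq).ne')).congr_deriv ?_
  have hsnd := snd_eq_cone hA (q t)
  obtain ⟨h1, h2, h3, h4, h5⟩ := hq
  rw [Real.sq_sqrt (sigma_pos ⟨h1, h2, h3, h4, h5⟩).le, one_add_sigma hA h3.ne', sigma]
  simp only [Pi.mul_apply]
  set p := -lam₁ A (q t)
  set r := lam₂ A (q t)
  set y := (q t).2
  have hsqrt : √(p * r / y) * √((1 + slope₁ A * p) * (1 + slope₂ A * r) / y) =
      √(r * (1 + slope₂ A * r) * (p * (1 + slope₁ A * p))) / y := by
    rw [← Real.sqrt_mul (by positivity), eq_div_iff h3.ne', ← Real.sqrt_sq h3.le,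
      ← Real.sqrt_mul (by positivity), Real.sqrt_sq h3.le]
    congr 1
    field_simp
  rw [one_div_mul_eq_div, div_div, mul_assoc 2 √(p * r / y), hsqrt]
  field_simp
  rw [hsnd]
  ring

/-- The reverse triangle inequality, infinitesimally. -/
theorem sqrt_le_of_mul_eq {p' r' X Y y g : ℝ} (hp' : 0 ≤ p') (hr' : 0 ≤ r') (hX : 0 < X)
    (hY : 0 < Y) (hy : 0 < y) (h : p' * r' = y ^ 2 * g) (hg : 0 ≤ g) :
    √g ≤ (p' * X + r' * Y) / (2 * y * √(X * Y)) := by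
  rw [le_div_iff₀ (by positivity)]
  refine (abs_le_of_sq_le_sq ?_ (by positivity)) |> (le_abs_self _).trans
  rw [mul_pow, mul_pow, mul_pow, Real.sq_sqrt hg, Real.sq_sqrt (by positivity)]
  have h1 : g * (2 ^ 2 * y ^ 2 * (X * Y)) = 4 * (p' * r') * (X * Y) := by rw [h]; ring
  rw [h1]
  linarith [sq_nonneg (p' * X - r' * Y)]

/-- The equality case of `sqrt_le_of_mul_eq` at unit speed: (p'X - r'Y)² = 0. -/
theorem mul_eq_mul_of_div_eq_one {p' r' X Y y : ℝ} (hX : 0 < X) (hY : 0 < Y) (hy : 0 < y)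
    (h : p' * r' = y ^ 2) (heq : (p' * X + r' * Y) / (2 * y * √(X * Y)) = 1) :
    p' * X = r' * Y := by
  rw [div_eq_one_iff_eq (by positivity)] at heq
  have h1 : (p' * X + r' * Y) ^ 2 = 4 * y ^ 2 * (X * Y) := by
    rw [heq, mul_pow, mul_pow, Real.sq_sqrt (by positivity)]; ring
  have h2 : (p' * X - r' * Y) ^ 2 = 0 := by
    rw [← h] at h1; linear_combination h1
  linarith [pow_eq_zero_iff (two_ne_zero) |>.1 h2]

end Distance

/-! ### Upper bound for length, and its equality case -/

section Maximizers

variable {A : Matrix (Fin 2) (Fin 2) ℝ}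

theorem IsCausalCurve.mul_ne_zero_of_le (hA : A.det ≠ 0) {q₁ : ℝ × ℝ} {T : ℝ} {q : ℝ → ℝ × ℝ}
    (hq : IsCausalCurve A Id q₁ T q) {s t : ℝ} (hs : s ∈ Icc 0 T) (ht : t ∈ Icc 0 T) (hst : s ≤ t)
    (h : -lam₁ A (q s) * lam₂ A (q s) ≠ 0) : -lam₁ A (q t) * lam₂ A (q t) ≠ 0 := by
  have hp0 := hq.lam₁_nonneg hA hs
  have hr0 := hq.lam₂_nonneg hA hs
  have hp := hq.monotone_lam₁ hA hs ht hst
  have hr := hq.monotone_lam₂ hA hs ht hst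
  exact (mul_pos ((hp0.lt_of_ne' (left_ne_zero_of_mul h)).trans_le hp)
    ((hr0.lt_of_ne' (right_ne_zero_of_mul h)).trans_le hr)).ne'

/-- The distance to `Id` grows at least as fast as the length of a causal curve. -/
theorem IsCausalCurve.integral_le (hA : A.det ≠ 0) {q₁ : ℝ × ℝ} {T : ℝ} {q : ℝ → ℝ × ℝ}
    (hq : IsCausalCurve A Id q₁ T q) (hq₁ : q₁ ∈ future A) {s t : ℝ} (hs : 0 ≤ s) (hst : s ≤ t)
    (ht : t ≤ T) (h : -lam₁ A (q s) * lam₂ A (q s) ≠ 0) {g : ℝ → ℝ}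
    (hg : IntervalIntegrable g volume s t)
    (hle : ∀ᵐ r, r ∈ Icc s t → g r ≤ √|form A (velocity q r)|) :
    ∫ r in s..t, g r ≤ lorentzDist A (q t) - lorentzDist A (q s) := by
  have hsub : Icc s t ⊆ Icc 0 T := Icc_subset_Icc hs ht
  have hfut : ∀ r ∈ Icc s t, q r ∈ future A := fun r hr => hq.mem_future hA hq₁ (hsub hr)
    (hq.mul_ne_zero_of_le hA (hsub ⟨le_rfl, hst⟩) (hsub hr) hr.1 h)
  obtain ⟨C, hC⟩ := hq.lipschitz
  refine integral_le_sub_of_absolutelyContinuous (f := fun r => lorentzDist A (q r)) hst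
    (absolutelyContinuous_comp hst (hC.mono hsub)
      fun r hr => contDiffAt_lorentzDist hA (hfut r hr)) hg ?_
  filter_upwards [hq.ae_deriv hA, hle] with r hr hgr hmem
  obtain ⟨p', r', h1, h2, h3, h4, h5⟩ := hr (hsub hmem)
  have hf := hfut r hmem
  refine ⟨_, hasDerivAt_lorentzDist hA hf h1 h2, (hgr hmem).trans ?_⟩
  exact sqrt_le_of_mul_eq h3 h4 (mul_pos hf.2.1 hf.2.2.2.2) (mul_pos hf.1 hf.2.2.2.1) hf.2.2.1 h5
    (abs_nonneg _)

/-- No causal curve is longer than the distance of its end point to `Id`. -/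
theorem IsCausalCurve.length_le (hA : A.det ≠ 0) {q₁ : ℝ × ℝ} {T : ℝ} {q : ℝ → ℝ × ℝ}
    (hq : IsCausalCurve A Id q₁ T q) (hq₁ : q₁ ∈ future A) :
    length A T q ≤ lorentzDist A q₁ := by
  have hpos := lorentzDist_pos hA hq₁
  rw [length]
  by_cases hint : IntervalIntegrable (fun t => √|form A (velocity q t)|) volume 0 T
  swap
  -- A non-integrable speed gives the default length 0.
  · rw [intervalIntegral.integral_undef hint]; exact hpos.le
  obtain ⟨C, hC⟩ := hq.lipschitz
  set Z : Set ℝ := {t ∈ Icc 0 T | -lam₁ A (q t) * lam₂ A (q t) = 0} with hZ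
  have hcont : ContinuousOn (fun t => -lam₁ A (q t) * lam₂ A (q t)) (Icc 0 T) :=
    (((contDiff_neg_lam₁ A).mul (contDiff_lam₂ A)).continuous.comp_continuousOn hC.continuousOn)
  have hZc : IsCompact Z := by
    have : IsClosed Z := hcont.preimage_isClosed_of_isClosed isClosed_Icc isClosed_singleton
    exact isCompact_Icc.of_isClosed_subset this fun t ht => ht.1
  have h0 : (0 : ℝ) ∈ Z := ⟨⟨le_rfl, hq.nonneg⟩, by simp [hq.start, lam₁_Id]⟩
  -- t₀ is the last time on the light cone of the identity: up to t₀ the curve is lightlike and has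
  -- no length, after t₀ it runs in `future`.
  obtain ⟨t₀, ht₀, hmax⟩ := hZc.exists_isGreatest ⟨0, h0⟩
  have ht₀T : t₀ < T := by
    refine ht₀.1.2.lt_of_ne fun h => ?_
    have := ht₀.2
    rw [h, hq.finish] at this
    exact (mul_pos hq₁.1 hq₁.2.1).ne' this
  have hint1 : IntervalIntegrable (fun t => √|form A (velocity q t)|) volume 0 t₀ :=
    hint.mono_set (by rw [uIcc_of_le ht₀.1.1, uIcc_of_le hq.nonneg]
                      exact Icc_subset_Icc_right ht₀.1.2)
  have hint2 : IntervalIntegrable (fun t => √|form A (velocity q t)|) volume t₀ T :=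
    hint.mono_set (by rw [uIcc_of_le ht₀T.le, uIcc_of_le hq.nonneg]
                      exact Icc_subset_Icc_left ht₀.1.1)
  rw [← intervalIntegral.integral_add_adjacent_intervals hint1 hint2]
  have hzero : ∫ t in (0 : ℝ)..t₀, √|form A (velocity q t)| = 0 := by
    refine intervalIntegral.integral_zero_ae ?_
    have hne : ∀ᵐ t : ℝ, t ≠ t₀ := by
      simp [ae_iff, measure_singleton]
    filter_upwards [hq.ae_form_eq_zero hA ht₀.1 ht₀.2, hne] with t ht hne hmem
    rw [uIoc_of_le ht₀.1.1] at hmem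
    rw [ht ⟨hmem.1, hmem.2.lt_of_ne hne⟩, abs_zero, Real.sqrt_zero]
  rw [hzero, zero_add]
  -- The calibration is smooth only inside `future`, so the bound is proved on [s, T] with s > t₀
  -- and passed to the limit s → t₀.
  have hlim : Filter.Tendsto (fun s => ∫ t in s..T, √|form A (velocity q t)|)
      (nhdsWithin t₀ (Ioi t₀)) (nhds (∫ t in t₀..T, √|form A (velocity q t)|)) := by
    have h1 := intervalIntegral.continuousOn_primitive_interval_left
      ((intervalIntegrable_iff' (by simp)).1 hint2)
    refine (h1 t₀ left_mem_uIcc).mono_left (nhdsWithin_le_of_mem ?_)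
    rw [uIcc_of_le ht₀T.le]
    exact Icc_mem_nhdsGT ht₀T
  refine le_of_tendsto hlim ?_
  filter_upwards [Ioo_mem_nhdsGT ht₀T] with s hs
  have hs0 : 0 ≤ s := ht₀.1.1.trans hs.1.le
  have hne : -lam₁ A (q s) * lam₂ A (q s) ≠ 0 := fun h =>
    (hmax ⟨⟨hs0, hs.2.le⟩, h⟩).not_gt hs.1
  have key := hq.integral_le hA hq₁ hs0 hs.2.le le_rfl hne (hint2.mono_set (by
    rw [uIcc_of_le hs.2.le, uIcc_of_le ht₀T.le]; exact Icc_subset_Icc_left hs.1.le))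
    (Filter.Eventually.of_forall fun _ _ => le_rfl)
  rw [hq.finish] at key
  have := lorentzDist_pos hA (hq.mem_future hA hq₁ ⟨hs0, hs.2.le⟩ hne)
  linarith

theorem IsArclength.length_eq {T : ℝ} (hT : 0 ≤ T) {q : ℝ → ℝ × ℝ} (h : IsArclength A T q) :
    length A T q = T := by
  rw [length, intervalIntegral.integral_congr_ae (g := fun _ => 1)]
  · simp
  · filter_upwards [(ae_restrict_iff' measurableSet_Icc).1 h] with t ht hmem
    rw [uIoc_of_le hT] at hmem
    rw [ht ⟨hmem.1.le, hmem.2⟩]; simp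

/-- An arclength-parametrized causal curve whose length is the distance of its end points is a
geodesic. -/
theorem IsCausalCurve.eq_geodesic (hA : A.det ≠ 0) {ψ T : ℝ} (hT : 0 < T)
    (hex : GeodesicExists A ψ T) {q : ℝ → ℝ × ℝ}
    (hq : IsCausalCurve A Id (geodesic A ψ T) T q) (harc : IsArclength A T q) :
    ∀ t ∈ Icc 0 T, q t = geodesic A ψ t := by
  have hq₁ := (hex.mem_future hA hT).1
  have harc' := (ae_restrict_iff' measurableSet_Icc).1 harc
  -- Unit speed forbids lightlike motion on a set of positive measure, so the light cone is left at
  -- once.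
  have hne : ∀ s ∈ Ioc 0 T, -lam₁ A (q s) * lam₂ A (q s) ≠ 0 := by
    intro s hs h0
    have h1 := hq.ae_form_eq_zero hA ⟨hs.1.le, hs.2⟩ h0
    have h2 : ∀ᵐ t : ℝ, t ∉ Ioo 0 s := by
      filter_upwards [h1, harc'] with t ht ht' hmem
      have := ht' ⟨hmem.1.le, hmem.2.le.trans hs.2⟩
      rw [ht hmem] at this
      norm_num at this
    have h3 : volume (Ioo 0 s) = 0 := measure_eq_zero_iff_ae_notMem.2 h2
    rw [Real.volume_Ioo] at h3
    simp [hs.1.not_ge] at h3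
  have hfut : ∀ s ∈ Ioc 0 T, q s ∈ future A := fun s hs =>
    hq.mem_future hA hq₁ ⟨hs.1.le, hs.2⟩ (hne s hs)
  have hsub : ∀ s t, 0 < s → s ≤ t → t ≤ T → t - s ≤ lorentzDist A (q t) - lorentzDist A (q s) := by
    intro s t hs hst ht
    have := hq.integral_le hA hq₁ hs.le hst ht (hne s ⟨hs, hst.trans ht⟩) (g := fun _ => 1)
      intervalIntegrable_const (by
        filter_upwards [harc'] with r hr hmem
        rw [hr ⟨hs.le.trans hmem.1, hmem.2.trans ht⟩]; simp)
    simpa using this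
  -- The growth estimate on [s, T], whose end has distance T, bounds the distance above by s. On [ε,
  -- s] it gives at least s - ε, and ε is arbitrary.
  have hdist : ∀ s ∈ Ioc 0 T, lorentzDist A (q s) = s := by
    intro s hs
    apply le_antisymm
    · have := hsub s T hs.1 hs.2 le_rfl
      rw [hq.finish, lorentzDist_geodesic hA hex hT] at this
      linarith
    · refine le_of_forall_pos_le_add fun ε hε => ?_
      rcases le_or_gt s ε with h | h
      · linarith [lorentzDist_pos hA (hfut s hs)]
      · have := hsub ε s hε h.le hs.2
        linarith [lorentzDist_pos hA (hfut ε ⟨hε, h.le.trans hs.2⟩)]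
  intro t ht
  rcases ht.1.eq_or_lt with rfl | ht0
  · rw [hq.start]; simp [geodesic, ofCone, Id]
  refine AffLorentz.eq_geodesic hA (hfut t ⟨ht0, ht.2⟩) (hdist t ⟨ht0, ht.2⟩) ?_
  obtain ⟨C, hC⟩ := hq.lipschitz
  have hIcc : Icc t T ⊆ Ioc 0 T := fun r hr => ⟨ht0.trans_le hr.1, hr.2⟩
  have hac : AbsolutelyContinuousOnInterval (fun r => ratio A (q r)) t T :=
    absolutelyContinuous_comp ht.2 (hC.mono (hIcc.trans Ioc_subset_Icc_self))
      fun r hr => contDiffAt_ratio (hfut r (hIcc hr))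
  -- The distance now has derivative 1, so equality holds in the inequality of means almost
  -- everywhere and `ratio` is constant; its value is that at the end point.
  obtain ⟨c, hc⟩ := hac.const_of_ae_hasDerivAt_zero (by
    have hneT : ∀ᵐ r : ℝ, r ≠ T := by simp [ae_iff, measure_singleton]
    filter_upwards [hq.ae_deriv hA, harc', hneT] with r hr har hrT hmem
    rw [uIcc_of_le ht.2] at hmem
    have hr0T := hIcc hmem
    have hf := hfut r hr0T
    obtain ⟨p', r', h1, h2, -, -, h5⟩ := hr (Ioc_subset_Icc_self hr0T)
    rw [har (Ioc_subset_Icc_self hr0T), abs_neg, abs_one, mul_one] at h5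
    have hd1 := hasDerivAt_lorentzDist hA hf h1 h2
    have heq : (fun s => lorentzDist A (q s)) =ᶠ[nhds r] fun s => s := by
      filter_upwards [Ioo_mem_nhds hr0T.1 (hr0T.2.lt_of_ne hrT)] with s hs
      exact hdist s ⟨hs.1, hs.2.le⟩
    have hone := hd1.unique ((hasDerivAt_id' r).congr_of_eventuallyEq heq)
    have hXY := mul_eq_mul_of_div_eq_one (mul_pos hf.2.1 hf.2.2.2.2) (mul_pos hf.1 hf.2.2.2.1)
      hf.2.2.1 h5 hone
    refine (hasDerivAt_ratio hf h1 h2).congr_deriv ?_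
    rw [hXY, sub_self, zero_div])
  rw [uIcc_of_le ht.2] at hc
  rw [hc t ⟨le_rfl, ht.2⟩, ← hc T ⟨ht.2, le_rfl⟩, hq.finish, (hex.mem_future hA hT).2.2]

end Maximizers

/-! ### Geodesics as maximizers -/

section GeodesicCurves

variable {A : Matrix (Fin 2) (Fin 2) ℝ}

theorem velocity_congr {q q' : ℝ → ℝ × ℝ} {T t : ℝ} (h : EqOn q q' (Icc 0 T))
    (ht : t ∈ Ioo 0 T) : velocity q t = velocity q' t := by
  have : q =ᶠ[nhds t] q' := by
    filter_upwards [Ioo_mem_nhds ht.1 ht.2] with s hs using h (Ioo_subset_Icc_self hs)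
  rw [velocity, velocity, this.deriv_eq, this.eq_of_nhds]

/-- The derivatives are two-sided, so values outside [0, T] matter at the ends; these two times are
null and are discarded. This carries properties from `geodesic` to `Exp`. -/
theorem IsCausalCurve.congr {q₀ q₁ : ℝ × ℝ} {T : ℝ} {q q' : ℝ → ℝ × ℝ}
    (hq : IsCausalCurve A q₀ q₁ T q) (h : EqOn q' q (Icc 0 T)) : IsCausalCurve A q₀ q₁ T q' where
  nonneg := hq.nonneg
  lipschitz := by
    obtain ⟨C, hC⟩ := hq.lipschitz
    exact ⟨C, fun s hs t ht => by rw [h hs, h ht]; exact hC hs ht⟩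
  mem t ht := by rw [h ht]; exact hq.mem t ht
  start := by rw [h ⟨le_rfl, hq.nonneg⟩]; exact hq.start
  finish := by rw [h ⟨hq.nonneg, le_rfl⟩]; exact hq.finish
  causal := by
    have hc := hq.causal
    rw [← Measure.restrict_congr_set Ioo_ae_eq_Icc, ae_restrict_iff' measurableSet_Ioo] at hc ⊢
    filter_upwards [hc] with t ht hmem
    obtain ⟨h1, h2, h3⟩ := ht hmem
    rw [velocity_congr h hmem]
    refine ⟨h1.congr_of_eventuallyEq ?_, h2, h3⟩
    filter_upwards [Ioo_mem_nhds hmem.1 hmem.2] with s hs using h (Ioo_subset_Icc_self hs)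

theorem IsArclength.congr {T : ℝ} {q q' : ℝ → ℝ × ℝ} (hq : IsArclength A T q)
    (h : EqOn q' q (Icc 0 T)) : IsArclength A T q' := by
  rw [IsArclength, ← Measure.restrict_congr_set Ioo_ae_eq_Icc, ae_restrict_iff' measurableSet_Ioo]
    at hq ⊢
  filter_upwards [hq] with t ht hmem
  rw [velocity_congr h hmem, ht hmem]

theorem contDiff_gsin_gcos (κ : ℝ) : ContDiff ℝ 1 (gsin κ) ∧ ContDiff ℝ 1 (gcos κ) := by
  have h1 : deriv (gsin κ) = gcos κ := funext fun t => (hasDerivAt_gsin κ t).deriv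
  have h2 : deriv (gcos κ) = fun t => κ * gsin κ t := funext fun t => (hasDerivAt_gcos κ t).deriv
  rw [contDiff_one_iff_deriv, contDiff_one_iff_deriv, h1, h2]
  exact ⟨⟨fun t => (hasDerivAt_gsin κ t).differentiableAt, continuous_gcos κ⟩,
    fun t => (hasDerivAt_gcos κ t).differentiableAt, continuous_const.mul (continuous_gsin κ)⟩

theorem contDiffAt_coneCoord {m n e t : ℝ} (h : coneDen m n e t ≠ 0) :
    ContDiffAt ℝ 1 (coneCoord m n e) t := by
  obtain ⟨h1, h2⟩ := contDiff_gsin_gcos (m * n)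
  exact (contDiffAt_const.mul h1.contDiffAt).div
    (h2.sub (contDiff_const.mul h1)).contDiffAt h

theorem exists_lipschitzOnWith_of_contDiffAt {E : Type*} [NormedAddCommGroup E] [NormedSpace ℝ E]
    {f : ℝ → E} {a b : ℝ} (hf : ∀ t ∈ Icc a b, ContDiffAt ℝ 1 f t) :
    ∃ C, LipschitzOnWith C f (Icc a b) := by
  refine LocallyLipschitzOn.exists_lipschitzOnWith_of_compact isCompact_Icc fun t ht => ?_
  obtain ⟨K, U, hU, hK⟩ := (hf t ht).exists_lipschitzOnWith
  exact ⟨K, U, mem_nhdsWithin_of_mem_nhds hU, hK⟩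

theorem GeodesicExists.contDiffAt {ψ T : ℝ} (h : GeodesicExists A ψ T) {t : ℝ}
    (ht : t ∈ Icc 0 T) : ContDiffAt ℝ 1 (geodesic A ψ) t := by
  have h1 := contDiffAt_coneCoord (h t ht).1.ne'
  have h2 := contDiffAt_coneCoord (h t ht).2.ne'
  exact (((contDiffAt_const.mul h2).add (contDiffAt_const.mul h1)).div_const 2).prodMk
    ((contDiffAt_const.add (contDiffAt_const.mul h2)).add (contDiffAt_const.mul h1))

/-- Here p' = f/χ², r' = e/φ² and y = 1/(φχ), hence p'r' = y² because ef = 1. -/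
theorem GeodesicExists.velocity_properties (hA : A.det ≠ 0) {ψ T : ℝ}
    (h : GeodesicExists A ψ T) {t : ℝ}
    (ht : t ∈ Icc 0 T) : DifferentiableAt ℝ (geodesic A ψ) t ∧
      form A (velocity (geodesic A ψ) t) = -1 ∧
      bilin A (Y₁ A) (velocity (geodesic A ψ) t) < 0 := by
  have hd := (h.contDiffAt ht).differentiableAt one_ne_zero
  obtain ⟨hφ, hχ⟩ := h t ht
  have hy := (h.mono ht.2).snd ht.1
  have hypos : 0 < (geodesic A ψ t).2 := by rw [hy]; positivity
  have hp : HasDerivAt (fun t => -lam₁ A (geodesic A ψ t))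
      (Real.exp (-ψ) / coneDen (slope₂ A) (slope₁ A) (Real.exp (-ψ)) t ^ 2) t := by
    simp only [geodesic, lam₁_ofCone hA, neg_neg]
    exact hasDerivAt_coneCoord (Real.exp_pos _).ne' hχ.ne'
  have hr : HasDerivAt (fun t => lam₂ A (geodesic A ψ t))
      (Real.exp ψ / coneDen (slope₁ A) (slope₂ A) (Real.exp ψ) t ^ 2) t := by
    simp only [geodesic, lam₂_ofCone hA]
    exact hasDerivAt_coneCoord (Real.exp_pos _).ne' hφ.ne'
  obtain ⟨h1, h2⟩ := form_velocity_eq hd hypos hp hr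
  refine ⟨hd, ?_, ?_⟩
  · rw [h1, hy]
    field_simp
    rw [exp_neg_mul_exp]
  · rw [bilin_Y₁ hA, h2, neg_lt_zero]
    positivity

theorem GeodesicExists.isCausalCurve (hA : A.det ≠ 0) {ψ T : ℝ} (hT : 0 ≤ T)
    (h : GeodesicExists A ψ T) : IsCausalCurve A Id (geodesic A ψ T) T (geodesic A ψ) where
  nonneg := hT
  lipschitz := exists_lipschitzOnWith_of_contDiffAt fun t ht => h.contDiffAt ht
  mem t ht := by
    obtain ⟨hφ, hχ⟩ := h t ht
    change 0 < (geodesic A ψ t).2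
    rw [(h.mono ht.2).snd ht.1]; positivity
  start := by simp [geodesic, ofCone, Id]
  finish := rfl
  causal := by
    refine (ae_restrict_iff' measurableSet_Icc).2 (Filter.Eventually.of_forall fun t ht => ?_)
    obtain ⟨h1, h2, h3⟩ := h.velocity_properties hA ht
    exact ⟨h1, by rw [h2]; norm_num, h3⟩

theorem GeodesicExists.isArclength (hA : A.det ≠ 0) {ψ T : ℝ}
    (h : GeodesicExists A ψ T) : IsArclength A T (geodesic A ψ) :=
  (ae_restrict_iff' measurableSet_Icc).2
    (Filter.Eventually.of_forall fun _ ht => (h.velocity_properties hA ht).2.1)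

/-- The geodesics are the unique arclength-parametrized maximizers. -/
theorem isMaximizer_Exp (hA : A.det ≠ 0) {ψ t₁ : ℝ} (hN : (ψ, t₁) ∈ N A) :
    IsMaximizer A Id (Exp A (ψ, t₁)) t₁ (fun t => Exp A (ψ, t)) ∧
      IsArclength A t₁ (fun t => Exp A (ψ, t)) ∧
      ∀ (T : ℝ) (q : ℝ → ℝ × ℝ), IsMaximizer A Id (Exp A (ψ, t₁)) T q → IsArclength A T q →
        T = t₁ ∧ ∀ t ∈ Icc 0 t₁, q t = Exp A (ψ, t) := by
  obtain ⟨ht₁, h⟩ := (mem_N_iff hA).1 hN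
  have heq : EqOn (fun t => Exp A (ψ, t)) (geodesic A ψ) (Icc 0 t₁) := fun t ht =>
    Exp_eq hA ht.1 (h.mono ht.2)
  have hfin := Exp_eq hA ht₁.le h
  have hfut := (h.mem_future hA ht₁).1
  have hc := (h.isCausalCurve hA ht₁.le).congr heq
  have harc := (h.isArclength hA).congr heq
  have hlen := harc.length_eq ht₁.le
  have hdist := lorentzDist_geodesic hA h ht₁
  rw [hfin]
  refine ⟨⟨hc, fun T' q' hq' => ?_⟩, harc, fun T q hq hqarc => ?_⟩
  · rw [hlen, ← hdist]
    exact hq'.length_le hA hfut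
  · have hT := hqarc.length_eq hq.1.nonneg
    have h1 := hq.1.length_le hA hfut
    have h2 := hq.2 _ _ hc
    rw [hT] at h1 h2
    rw [hdist] at h1
    rw [hlen] at h2
    -- T is the length of q: at most the distance t₁, and at least the length t₁ of the geodesic by
    -- maximality.
    obtain rfl : T = t₁ := le_antisymm h1 h2
    refine ⟨rfl, fun t ht => ?_⟩
    rw [hq.1.eq_geodesic hA ht₁ h hqarc t ht]
    exact (heq ht).symm

end GeodesicCurves

/-! ### Identification of M -/

section Domain

variable {A : Matrix (Fin 2) (Fin 2) ℝ}

/-- From an interior point one can move a little against the gradient (a, b) without leaving the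
set, and this strictly decreases the function. -/
theorem pos_of_mem_interior {a b : ℝ} (hab : a ^ 2 + b ^ 2 ≠ 0) {s : Set (ℝ × ℝ)}
    (hs : ∀ q ∈ s, 0 ≤ a * q.1 + b * (q.2 - 1)) {q : ℝ × ℝ} (hq : q ∈ interior s) :
    0 < a * q.1 + b * (q.2 - 1) := by
  have hcont : Filter.Tendsto (fun ε : ℝ => (q.1 - ε * a, q.2 - ε * b)) (nhdsWithin 0 (Ioi 0))
      (nhds q) := by
    have : Continuous fun ε : ℝ => (q.1 - ε * a, q.2 - ε * b) := by fun_prop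
    simpa using (this.tendsto 0).mono_left nhdsWithin_le_nhds
  obtain ⟨ε, h1, h2⟩ := ((hcont.eventually (mem_interior_iff_mem_nhds.1 hq)).and
    self_mem_nhdsWithin).exists
  have h3 := hs _ h1
  have h4 : 0 < ε * (a ^ 2 + b ^ 2) := mul_pos h2 (lt_of_le_of_ne (by positivity) hab.symm)
  simp only at h3
  linarith

theorem isOpen_future (A : Matrix (Fin 2) (Fin 2) ℝ) : IsOpen (future A) := by
  have h1 := (contDiff_neg_lam₁ A).continuous
  have h2 := (contDiff_lam₂ A).continuous
  simp only [future, ofPred_and]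
  exact (isOpen_lt continuous_const h1).inter ((isOpen_lt continuous_const h2).inter
    ((isOpen_lt continuous_const continuous_snd).inter
    ((isOpen_lt continuous_const (continuous_const.add (continuous_const.mul h1))).inter
    (isOpen_lt continuous_const (continuous_const.add (continuous_const.mul h2))))))

theorem neg_lam₁_pos_of_mem_interior (hA : A.det ≠ 0) {s : Set (ℝ × ℝ)}
    (hs : ∀ q ∈ s, 0 ≤ -lam₁ A q) {q : ℝ × ℝ} (hq : q ∈ interior s) : 0 < -lam₁ A q := by
  have key := pos_of_mem_interior (a := A 0 0 - A 1 0) (b := A 0 1 - A 1 1) (fun h0 => hA ?_)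
    (fun q hq => by have := hs q hq; rw [lam₁] at this; linarith) hq
  · rw [lam₁]; linarith
  · have h1 : A 0 0 = A 1 0 := by nlinarith [sq_nonneg (A 0 0 - A 1 0), sq_nonneg (A 0 1 - A 1 1)]
    have h2 : A 0 1 = A 1 1 := by nlinarith [sq_nonneg (A 0 0 - A 1 0), sq_nonneg (A 0 1 - A 1 1)]
    rw [Matrix.det_fin_two, h1, h2]; ring

theorem lam₂_pos_of_mem_interior (hA : A.det ≠ 0) {s : Set (ℝ × ℝ)}
    (hs : ∀ q ∈ s, 0 ≤ lam₂ A q) {q : ℝ × ℝ} (hq : q ∈ interior s) : 0 < lam₂ A q := by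
  have key := pos_of_mem_interior (a := A 1 0 + A 0 0) (b := A 1 1 + A 0 1) (fun h0 => hA ?_)
    (fun q hq => by have := hs q hq; rw [lam₂] at this; linarith) hq
  · rw [lam₂]; linarith
  · have h1 : A 0 0 = -A 1 0 := by nlinarith [sq_nonneg (A 1 0 + A 0 0), sq_nonneg (A 1 1 + A 0 1)]
    have h2 : A 0 1 = -A 1 1 := by nlinarith [sq_nonneg (A 1 0 + A 0 0), sq_nonneg (A 1 1 + A 0 1)]
    rw [Matrix.det_fin_two, h1, h2]; ring

/-- The slopes have opposite signs, and a ≥ 0 decides which is positive, because `slope₂ A - slope₁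
A` is δ = a / det A. -/
theorem slope_of_K_neg (hdet : 0 < A.det) (ha : 0 ≤ A 0 0) (hK : K A < 0) :
    slope₁ A < 0 ∧ 0 < slope₂ A := by
  rw [K_eq hdet.ne'] at hK
  have h : 0 ≤ slope₂ A - slope₁ A := by
    rw [slope₁, slope₂, inv_one_one]
    have := div_nonneg ha hdet.le
    linarith
  have h' : slope₁ A * slope₂ A < 0 := by linarith
  rcases mul_neg_iff.1 h' with h1 | h1
  · linarith
  · exact h1

theorem slope_eq (hdet : 0 < A.det) : slope₁ A = -(A 1 0 + A 0 0) / (2 * A.det) := by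
  rw [slope₁, inv_one_zero, inv_one_one]; field_simp; ring

/-- For K < 0 the condition on λ₃ is 1 + m p > 0, and n > 0 makes 1 + n r > 0 automatic. For K ≥ 0
both conditions are automatic: if m < 0 then n ≤ 0, so 1 + m p = y - n r > 0, and symmetrically.
Conversely, geodesics reach every point of `future`. -/
theorem M_eq_future (hdet : 0 < A.det) (ha : 0 ≤ A 0 0) : M A = future A := by
  have hA := hdet.ne'
  rw [M]
  split_ifs with hK
  · obtain ⟨hm, hn⟩ := slope_of_K_neg hdet ha hK
    have hs : 0 < A 1 0 + A 0 0 := by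
      rw [slope_eq hdet, div_neg_iff] at hm
      rcases hm with h | h <;> linarith
    have hcoef : 0 < 2 * A.det / (A 1 0 + A 0 0) := by positivity
    apply Subset.antisymm
    · intro q hq
      have hD := interior_subset hq
      have h1 := neg_lam₁_pos_of_mem_interior hA (s := D A) (fun q hq => neg_nonneg.2 hq.2.1) hq
      have h2 := lam₂_pos_of_mem_interior hA (s := D A) (fun q hq => hq.2.2.1) hq
      have h3 := hD.2.2.2
      rw [lam₃_eq hA hs.ne'] at h3
      exact ⟨h1, h2, hD.1, pos_of_mul_pos_right h3 hcoef.le, by positivity⟩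
    · refine interior_maximal (fun q hq => ?_) (isOpen_future A)
      refine ⟨hq.2.2.1, by linarith [hq.1], hq.2.1.le, ?_⟩
      rw [lam₃_eq hA hs.ne']
      exact mul_pos hcoef hq.2.2.2.1
  · apply Subset.antisymm
    · intro q hq
      obtain ⟨T, c, hc⟩ := interior_subset hq
      have hT : T ∈ Icc 0 T := ⟨hc.nonneg, le_rfl⟩
      have hJ1 : ∀ q ∈ causalFuture A Id, 0 ≤ -lam₁ A q := by
        rintro q ⟨T, c, hc⟩
        rw [← hc.finish]; exact hc.lam₁_nonneg hA ⟨hc.nonneg, le_rfl⟩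
      have hJ2 : ∀ q ∈ causalFuture A Id, 0 ≤ lam₂ A q := by
        rintro q ⟨T, c, hc⟩
        rw [← hc.finish]; exact hc.lam₂_nonneg hA ⟨hc.nonneg, le_rfl⟩
      have h1 := neg_lam₁_pos_of_mem_interior hA hJ1 hq
      have h2 := lam₂_pos_of_mem_interior hA hJ2 hq
      have h3 : 0 < q.2 := hc.finish ▸ hc.mem T hT
      have h4 := snd_eq_cone hA q
      rw [K_eq hA, not_lt] at hK
      have hmn : 0 ≤ slope₁ A * slope₂ A := by linarith
      refine ⟨h1, h2, h3, ?_, ?_⟩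
      · rcases le_or_gt 0 (slope₁ A) with h | h
        · positivity
        · have : slope₂ A ≤ 0 := by nlinarith
          nlinarith
      · rcases le_or_gt 0 (slope₂ A) with h | h
        · positivity
        · have : slope₁ A ≤ 0 := by nlinarith
          nlinarith
    · refine interior_maximal (fun q hq => ?_) (isOpen_future A)
      obtain ⟨ψ, t, ht, h, rfl⟩ := exists_geodesic hA hq
      exact ⟨t, _, h.isCausalCurve hA ht.le⟩

end Domain

/-! ### Solving y and w for the parameters ρ and τ -/

section Formulas

/-- The relations are equivalent to y cos τ = cos ρ and y sin τ = w + sin ρ; eliminating one angle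
by cos² + sin² = 1 leaves a linear equation for the sine of the other. -/
theorem negative_formula {ρ τ y w : ℝ} (hρ : 0 < Real.cos ρ) (hτ : 0 < Real.cos τ)
    (hρτ : 0 < Real.sin (τ - ρ)) (hy : y = Real.cos ρ / Real.cos τ)
    (hw : w = Real.sin (τ - ρ) / Real.cos τ) :
    0 < w ∧ (y ^ 2 + w ^ 2 - 1) / (2 * y * w) = Real.sin τ ∧
      (y ^ 2 - w ^ 2 - 1) / (2 * w) = Real.sin ρ := by
  have hw0 : 0 < w := by rw [hw]; positivity
  have hy0 : 0 < y := by rw [hy]; positivity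
  have h1 : y * Real.cos τ = Real.cos ρ := by rw [hy]; field_simp
  have h2 : w * Real.cos τ = Real.sin τ * Real.cos ρ - Real.cos τ * Real.sin ρ := by
    rw [hw, ← Real.sin_sub]; field_simp
  have h3 : w + Real.sin ρ = y * Real.sin τ := by
    refine mul_right_cancel₀ hτ.ne' ?_
    linear_combination h2 - Real.sin τ * h1
  have h4 := Real.sin_sq_add_cos_sq τ
  have h5 := Real.sin_sq_add_cos_sq ρ
  refine ⟨hw0, ?_, ?_⟩
  · rw [div_eq_iff (by positivity)]
    have h6 : (w - y * Real.sin τ) ^ 2 = Real.sin ρ ^ 2 := by rw [← h3]; ring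
    have h7 : (y * Real.cos τ) ^ 2 = Real.cos ρ ^ 2 := by rw [h1]
    linear_combination h6 + h7 + h5 - y ^ 2 * h4
  · rw [div_eq_iff (by positivity)]
    have h6 : (w + Real.sin ρ) ^ 2 = (y * Real.sin τ) ^ 2 := by rw [h3]
    have h7 : (y * Real.cos τ) ^ 2 = Real.cos ρ ^ 2 := by rw [h1]
    linear_combination -h6 + h7 + h5 - y ^ 2 * h4

/-- The hyperbolic analogue: y sinh τ = sinh ρ and y cosh τ = cosh ρ - w. -/
theorem positive_formula {ρ τ y w : ℝ} (hτ : 0 < Real.sinh τ) (hρ : 0 < Real.sinh ρ)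
    (hρτ : Real.sinh (ρ - τ) ≠ 0) (hy : y = Real.sinh ρ / Real.sinh τ)
    (hw : w = -Real.sinh (ρ - τ) / Real.sinh τ) :
    (1 - y ^ 2 - w ^ 2) / (2 * y * w) = Real.cosh τ ∧
      (1 - y ^ 2 + w ^ 2) / (2 * w) = Real.cosh ρ := by
  have hw0 : w ≠ 0 := by rw [hw]; exact div_ne_zero (neg_ne_zero.2 hρτ) hτ.ne'
  have hy0 : 0 < y := by rw [hy]; positivity
  have h1 : y * Real.sinh τ = Real.sinh ρ := by rw [hy]; field_simp
  have h2 : w * Real.sinh τ = -(Real.sinh ρ * Real.cosh τ - Real.cosh ρ * Real.sinh τ) := by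
    rw [hw, ← Real.sinh_sub]; field_simp
  have h3 : w + y * Real.cosh τ = Real.cosh ρ := by
    refine mul_right_cancel₀ hτ.ne' ?_
    linear_combination h2 + Real.cosh τ * h1
  have h4 := Real.cosh_sq τ
  have h5 := Real.cosh_sq ρ
  have h7 : (y * Real.sinh τ) ^ 2 = Real.sinh ρ ^ 2 := by rw [h1]
  constructor
  · rw [div_eq_iff (by positivity)]
    have h6 : (w + y * Real.cosh τ) ^ 2 = Real.cosh ρ ^ 2 := by rw [h3]
    linear_combination y ^ 2 * h4 - h6 + h7 - h5
  · rw [div_eq_iff (by positivity)]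
    have h6 : (w - Real.cosh ρ) ^ 2 = (y * Real.cosh τ) ^ 2 := by rw [← h3]; ring
    linear_combination h6 + y ^ 2 * h4 + h7 - h5

/-- The two radicands are f² and (f - ct)², so the roots differ by ct. -/
theorem zero_formula {c e f t y w : ℝ} (hc : c ≠ 0) (hf : 0 < f) (hef : e * f = 1) (ht : 0 < t)
    (hφ : 0 < 1 - c * e * t) (hy : y = 1 / (1 - c * e * t)) (hw : w = -c * (f * t)) :
    y ≠ 1 ∧ 0 < w / (y - y ^ 2) ∧ 0 < w * y / (1 - y) ∧ √(w * y / (1 - y)) = f ∧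
      (√(w * y / (1 - y)) - √(w / (y - y ^ 2))) / c = t := by
  have he : e ≠ 0 := left_ne_zero_of_mul_eq_one hef
  have hyφ : y * (1 - c * e * t) = 1 := by rw [hy, one_div_mul_cancel hφ.ne']
  have hy0 : y ≠ 0 := left_ne_zero_of_mul_eq_one hyφ
  have h1 : 1 - y = -(c * e * t) * y := by linear_combination -hyφ
  have hne : 1 - y ≠ 0 := by
    rw [h1]
    exact mul_ne_zero (neg_ne_zero.2 (mul_ne_zero (mul_ne_zero hc he) ht.ne')) hy0
  have h2 : w * y / (1 - y) = f ^ 2 := by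
    rw [div_eq_iff hne, h1, hw]
    linear_combination (c * f * t * y) * hef
  have h3 : w / (y - y ^ 2) = (f * (1 - c * e * t)) ^ 2 := by
    have : y - y ^ 2 = y * (1 - y) := by ring
    rw [this, div_eq_iff (mul_ne_zero hy0 hne), h1, hw]
    linear_combination (c * f * t) * (y * (1 - c * e * t)) ^ 2 * hef +
      (c * f * t) * (y * (1 - c * e * t) + 1) * hyφ
  rw [h2, h3, Real.sqrt_sq hf.le, Real.sqrt_sq (by positivity)]
  refine ⟨fun h => hne (by rw [h, sub_self]), by positivity, by positivity, rfl, ?_⟩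
  rw [div_eq_iff hc]
  linear_combination c * t * hef

variable {A : Matrix (Fin 2) (Fin 2) ℝ}

theorem exists_ExpInv_eq (hdet : 0 < A.det) (ha : 0 ≤ A 0 0) {q : ℝ × ℝ} (hq : q ∈ M A) :
    ∃ ψ t, 0 < t ∧ GeodesicExists A ψ t ∧ geodesic A ψ t = q ∧ ExpInv A q = (ψ, t) := by
  rw [M_eq_future hdet ha] at hq
  obtain ⟨ψ, t, ht, h, rfl⟩ := exists_geodesic hdet.ne' hq
  refine ⟨ψ, t, ht, h, rfl, ?_⟩
  have hN := (mem_N_iff hdet.ne').2 ⟨ht, h⟩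
  have := (bijOn_Exp_future hdet.ne').injOn.leftInvOn_invFunOn hN
  rwa [Exp_eq hdet.ne' ht.le h] at this

end Formulas

/-! ### The inverse of the exponential mapping in the three cases -/

section Inverse

variable {A : Matrix (Fin 2) (Fin 2) ℝ}

/-- Explains w: it is n r - m p, the companion of y - 1 = n r + m p. The number d is Δ² for K < 0
and -Δ² for K > 0, where the formula's w has the opposite sign. -/
theorem cone_combination (hA : A.det ≠ 0) {d : ℝ} (hd : d ≠ 0)
    (h : d = A⁻¹ 1 1 ^ 2 - A⁻¹ 1 0 ^ 2) (q : ℝ × ℝ) :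
    (q.1 - (A⁻¹ 0 1 * A⁻¹ 1 1 - A⁻¹ 0 0 * A⁻¹ 1 0) / d * (q.2 - 1)) /
      ((A⁻¹ 0 0 * A⁻¹ 1 1 - A⁻¹ 0 1 * A⁻¹ 1 0) / d) =
      slope₂ A * lam₂ A q - slope₁ A * -lam₁ A q := by
  have hD : A⁻¹ 0 0 * A⁻¹ 1 1 - A⁻¹ 0 1 * A⁻¹ 1 0 ≠ 0 :=
    right_ne_zero_of_mul_eq_one (det_mul_det_inv hA)
  have h1 : q.1 = ((A⁻¹ 0 0 - A⁻¹ 0 1) * -lam₁ A q + (A⁻¹ 0 0 + A⁻¹ 0 1) * lam₂ A q) / 2 :=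
    (congrArg Prod.fst (ofCone_lam hA q)).symm
  have h2 := snd_eq_cone hA q
  rw [div_eq_iff (div_ne_zero hD hd), h1, h2]
  simp only [slope₁, slope₂]
  field_simp
  rw [h]
  ring

theorem K_eq_sub (hA : A.det ≠ 0) : K A = A⁻¹ 1 0 ^ 2 - A⁻¹ 1 1 ^ 2 := by
  rw [K_eq hA, slope₁, slope₂]; ring

theorem lam_geodesic (hA : A.det ≠ 0) (ψ t : ℝ) :
    -lam₁ A (geodesic A ψ t) = coneCoord (slope₂ A) (slope₁ A) (Real.exp (-ψ)) t ∧
    lam₂ A (geodesic A ψ t) = coneCoord (slope₁ A) (slope₂ A) (Real.exp ψ) t := by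
  rw [geodesic, lam₁_ofCone hA, lam₂_ofCone hA, neg_neg]; exact ⟨rfl, rfl⟩

theorem sin_mem_Ioo {r : ℝ} (hr : r ∈ Ioo (-(Real.pi / 2)) (Real.pi / 2)) :
    Real.sin r ∈ Ioo (-1 : ℝ) 1 := by
  have h1 := pow_pos (Real.cos_pos_of_mem_Ioo hr) 2
  have h2 := Real.sin_sq_add_cos_sq r
  rw [mem_Ioo, ← abs_lt, ← sq_lt_one_iff_abs_lt_one]
  linarith

theorem ExpInv_of_K_neg (hdet : 0 < A.det) (ha : 0 ≤ A 0 0) (hK : K A < 0) {x₁ y₁ : ℝ}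
    (hM : (x₁, y₁) ∈ M A) :
    let α := A⁻¹ 0 0
    let β := A⁻¹ 0 1
    let γ := A⁻¹ 1 0
    let δ := A⁻¹ 1 1
    let Δ := √(δ ^ 2 - γ ^ 2)
    let θ := Real.arsinh (γ / Δ)
    let l := (α * δ - β * γ) / Δ ^ 2
    let ν := (β * δ - α * γ) / Δ ^ 2
    let w := (x₁ - ν * (y₁ - 1)) / l
    let τ := Real.arcsin ((y₁ ^ 2 + w ^ 2 - 1) / (2 * y₁ * w))
    let ρ := Real.arcsin ((y₁ ^ 2 - w ^ 2 - 1) / (2 * w))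
    0 < Δ ∧ δ = Δ * Real.cosh θ ∧ γ = Δ * Real.sinh θ ∧ l ≠ 0 ∧ w ≠ 0 ∧
      (y₁ ^ 2 + w ^ 2 - 1) / (2 * y₁ * w) ∈ Set.Ioo (-1 : ℝ) 1 ∧
      (y₁ ^ 2 - w ^ 2 - 1) / (2 * w) ∈ Set.Ioo (-1 : ℝ) 1 ∧
      ExpInv A (x₁, y₁) = (Real.arsinh (Real.tan ρ) - θ, (τ - ρ) / Δ) := by
  intro α β γ δ Δ θ l ν w τ ρ
  have hA := hdet.ne'
  obtain ⟨ψ, t, ht, hex, hq, hinv⟩ := exists_ExpInv_eq hdet ha hM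
  have hsq : 0 < δ ^ 2 - γ ^ 2 := by rw [K_eq_sub hA] at hK; linarith
  have hΔ : 0 < Δ := Real.sqrt_pos.2 hsq
  have hΔ2 : Δ ^ 2 = δ ^ 2 - γ ^ 2 := Real.sq_sqrt hsq.le
  have hsinh : γ = Δ * Real.sinh θ := by
    rw [Real.sinh_arsinh]; field_simp
  have hδ : 0 < δ := by
    obtain ⟨hm, hn⟩ := slope_of_K_neg hdet ha hK
    have : δ = slope₂ A - slope₁ A := by rw [slope₁, slope₂]; ring
    linarith
  have hcosh : δ = Δ * Real.cosh θ := by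
    refine (sq_eq_sq₀ hδ.le (by positivity)).1 ?_
    rw [mul_pow, Real.cosh_sq, mul_add, ← mul_pow, ← hsinh, hΔ2]; ring
  have hD : α * δ - β * γ ≠ 0 := right_ne_zero_of_mul_eq_one (det_mul_det_inv hA)
  have hl : l ≠ 0 := div_ne_zero hD (pow_ne_zero 2 hΔ.ne')
  have hw : w = slope₂ A * lam₂ A (x₁, y₁) - slope₁ A * -lam₁ A (x₁, y₁) :=
    cone_combination hA (pow_ne_zero 2 hΔ.ne') hΔ2 (x₁, y₁)
  have hn : slope₂ A = Δ / 2 * Real.exp θ := by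
    rw [slope₂, ← Real.cosh_add_sinh]; linarith
  have hm : slope₁ A = -(Δ / 2) * Real.exp (-θ) := by
    rw [slope₁, ← Real.cosh_sub_sinh]; linarith
  have hκ : slope₁ A * slope₂ A = -(Δ / 2) ^ 2 := by
    rw [hn, hm]; linear_combination (-(Δ / 2) ^ 2) * exp_neg_mul_exp θ
  have hκ' : slope₂ A * slope₁ A = -(Δ / 2) ^ 2 := by rw [mul_comm, hκ]
  have hneg : -(Δ / 2) ^ 2 < 0 := by rw [neg_lt_zero]; positivity
  have hroot : √(- -(Δ / 2) ^ 2) = Δ / 2 := by rw [neg_neg, Real.sqrt_sq (by positivity)]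
  set c := Δ / 2 * t with hc
  have hc0 : 0 < c := by positivity
  -- Otherwise C = cos(Δt/2) would vanish during the life of the geodesic.
  have hcπ : c < Real.pi / 2 := by
    by_contra! hle
    have := hex.gcos_pos (Real.pi / 2 / (Δ / 2)) ⟨by positivity, by
      rw [div_le_iff₀ (by positivity)]; linarith⟩
    rw [hκ, gcos_of_neg hneg, hroot, mul_div_cancel₀ _ (by positivity), Real.cos_pi_div_two] at this
    exact this.false
  -- With tan a = exp(ψ + θ) the denominators become φ = cos(a + c)/cos a and χ = sin(a + c)/sin a.
  -- Time acts as a shift of the angle, and existence means a + c < π/2.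
  set a := Real.arctan (Real.exp (ψ + θ)) with ha_def
  have htan : Real.tan a = Real.exp (ψ + θ) := Real.tan_arctan _
  have ha0 : 0 < a := Real.arctan_pos.2 (Real.exp_pos _)
  have haπ : a < Real.pi / 2 := Real.arctan_lt_pi_div_two _
  have hcosa : 0 < Real.cos a := Real.cos_pos_of_mem_Ioo ⟨by linarith, haπ⟩
  have hsina : 0 < Real.sin a := Real.sin_pos_of_pos_of_lt_pi ha0 (by linarith)
  have he : Real.exp θ * Real.exp ψ = Real.sin a / Real.cos a := by
    rw [← Real.exp_add, add_comm, ← htan, Real.tan_eq_sin_div_cos]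
  have hf : Real.exp (-θ) * Real.exp (-ψ) = Real.cos a / Real.sin a := by
    rw [← inv_div, ← he, ← Real.exp_add, ← Real.exp_add, ← Real.exp_neg]; ring_nf
  have hC : gcos (-(Δ / 2) ^ 2) t = Real.cos c := by rw [gcos_of_neg hneg, hroot]
  have hS : gsin (-(Δ / 2) ^ 2) t = Real.sin c / (Δ / 2) := by rw [gsin_of_neg hneg, hroot]
  have hne : slope₂ A * (Real.exp ψ * (Real.sin c / (Δ / 2))) =
      Real.sin a / Real.cos a * Real.sin c := by
    rw [hn, ← he]; field_simp
  have hmf : slope₁ A * (Real.exp (-ψ) * (Real.sin c / (Δ / 2))) =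
      -(Real.cos a / Real.sin a * Real.sin c) := by
    rw [hm, ← hf]; field_simp
  have hφ : coneDen (slope₁ A) (slope₂ A) (Real.exp ψ) t = Real.cos (a + c) / Real.cos a := by
    rw [coneDen, hκ, hC, hS, mul_assoc, hne, Real.cos_add]
    field_simp
  have hχ : coneDen (slope₂ A) (slope₁ A) (Real.exp (-ψ)) t = Real.sin (a + c) / Real.sin a := by
    rw [coneDen, hκ', hC, hS, mul_assoc, hmf, Real.sin_add]
    field_simp
    ring
  obtain ⟨hφ0, hχ0⟩ := hex t ⟨ht.le, le_rfl⟩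
  have hcosb : 0 < Real.cos (a + c) :=
    (div_pos_iff_of_pos_right hcosa).1 (hφ ▸ hφ0)
  have hsinb : 0 < Real.sin (a + c) :=
    (div_pos_iff_of_pos_right hsina).1 (hχ ▸ hχ0)
  have hbπ : a + c < Real.pi / 2 := by
    by_contra! hle
    exact hcosb.not_ge (Real.cos_nonpos_of_pi_div_two_le_of_le hle (by linarith))
  -- Doubling turns the products sin · cos in y = 1/(φχ) into single cosines; subtracting π/2 brings
  -- both angles into the range of `arcsin`.
  set ρ' := 2 * a - Real.pi / 2
  set τ' := 2 * (a + c) - Real.pi / 2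
  have hcosρ : Real.cos ρ' = 2 * Real.sin a * Real.cos a := by
    rw [Real.cos_sub_pi_div_two, Real.sin_two_mul]
  have hcosτ : Real.cos τ' = 2 * Real.sin (a + c) * Real.cos (a + c) := by
    rw [Real.cos_sub_pi_div_two, Real.sin_two_mul]
  have hsub : τ' - ρ' = 2 * c := by ring
  have hsinc : 0 < Real.sin (2 * c) := Real.sin_pos_of_pos_of_lt_pi (by linarith) (by linarith)
  obtain ⟨hp, hr⟩ := lam_geodesic hA ψ t
  rw [hq] at hp hr
  have hy : y₁ = Real.cos ρ' / Real.cos τ' := by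
    have := hex.snd ht.le
    rw [hq, hφ, hχ] at this
    change y₁ = _ at this
    rw [this, hcosρ, hcosτ]
    field_simp
  have hwv : w = Real.sin (τ' - ρ') / Real.cos τ' := by
    have hcos : Real.cos c = Real.cos (a + c) * Real.cos a + Real.sin (a + c) * Real.sin a := by
      rw [← Real.cos_sub]; ring_nf
    rw [hw, hp, hr, coneCoord, coneCoord, hφ, hχ, hκ, hκ', hS,
      ← mul_div_assoc (slope₂ A), ← mul_div_assoc (slope₁ A), hne, hmf, hsub, Real.sin_two_mul, hcosτ, hcos]
    field_simp
    ring
  obtain ⟨hw0, h1, h2⟩ := negative_formula (by rw [hcosρ]; positivity) (by rw [hcosτ]; positivity)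
    (by rw [hsub]; exact hsinc) hy hwv
  have hτmem : τ' ∈ Ioo (-(Real.pi / 2)) (Real.pi / 2) := by
    constructor <;> simp only [τ'] <;> linarith
  have hρmem : ρ' ∈ Ioo (-(Real.pi / 2)) (Real.pi / 2) := by
    constructor <;> simp only [ρ'] <;> linarith
  have hτ : τ = τ' := by
    simp only [τ]; rw [h1, Real.arcsin_sin hτmem.1.le hτmem.2.le]
  have hρ : ρ = ρ' := by
    simp only [ρ]; rw [h2, Real.arcsin_sin hρmem.1.le hρmem.2.le]
  refine ⟨hΔ, hcosh, hsinh, hl, hw0.ne', by rw [h1]; exact sin_mem_Ioo hτmem,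
    by rw [h2]; exact sin_mem_Ioo hρmem, ?_⟩
  rw [hinv, hτ, hρ, hsub]
  refine Prod.ext ?_ ?_
  · have : Real.tan ρ' = Real.sinh (ψ + θ) := by
      rw [Real.tan_eq_sin_div_cos, hcosρ, Real.sin_sub_pi_div_two, Real.cos_two_mul', Real.sinh_eq,
        neg_add, Real.exp_add, Real.exp_add, mul_comm (Real.exp ψ),
        mul_comm (Real.exp (-ψ)), he, hf]
      field_simp
      ring
    simp only [this, Real.arsinh_sinh]; ring
  · simp only [hc]; field_simp

theorem hyperbolic_product (s u : ℝ) :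
    (Real.cosh s - Real.exp u * Real.sinh s) * (Real.cosh s - Real.exp (-u) * Real.sinh s) =
      Real.cosh (2 * s) - Real.sinh (2 * s) * Real.cosh u := by
  rw [Real.cosh_two_mul, Real.sinh_two_mul, Real.cosh_eq u]
  linear_combination Real.sinh s ^ 2 * exp_mul_exp_neg u

theorem hyperbolic_combination {s u : ℝ} (h₁ : Real.cosh s - Real.exp u * Real.sinh s ≠ 0)
    (h₂ : Real.cosh s - Real.exp (-u) * Real.sinh s ≠ 0) :
    Real.exp (-u) * Real.sinh s / (Real.cosh s - Real.exp (-u) * Real.sinh s) -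
        Real.exp u * Real.sinh s / (Real.cosh s - Real.exp u * Real.sinh s) =
      -(Real.sinh (2 * s) * Real.sinh u * (1 / ((Real.cosh s - Real.exp u * Real.sinh s) *
        (Real.cosh s - Real.exp (-u) * Real.sinh s)))) := by
  rw [Real.sinh_two_mul, Real.sinh_eq u, div_sub_div _ _ h₂ h₁, mul_one_div, ← neg_div,
    mul_comm (Real.cosh s - Real.exp u * _)]
  congr 1
  ring

/-- Choose ρ > 0 with coth ρ = cosh u. Then 1/y = sinh(ρ - 2s)/sinh ρ, so τ = ρ - 2s is positive too
and `positive_formula` applies to σw. The sign of u, which `arcosh` loses, is restored by σ. -/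
theorem hyperbolic_inverse {u s y w σ : ℝ} (hs : s ≠ 0) (hσ : σ = 1 ∨ σ = -1) (hu : 0 < σ * u)
    (hden : 0 < Real.cosh (2 * s) - Real.sinh (2 * s) * Real.cosh u)
    (hy : y = 1 / (Real.cosh (2 * s) - Real.sinh (2 * s) * Real.cosh u))
    (hw : w = -(Real.sinh (2 * s) * Real.sinh u * y)) :
    1 < σ * ((1 - y ^ 2 - w ^ 2) / (2 * y * w)) ∧
      1 < σ * ((1 - y ^ 2 + w ^ 2) / (2 * w)) ∧
      σ * Real.arcosh (coth (Real.arcosh (σ * ((1 - y ^ 2 + w ^ 2) / (2 * w))))) = u ∧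
      Real.arcosh (σ * ((1 - y ^ 2 + w ^ 2) / (2 * w))) -
        Real.arcosh (σ * ((1 - y ^ 2 - w ^ 2) / (2 * y * w))) = 2 * s := by
  have hσ2 : σ * σ = 1 := by rcases hσ with rfl | rfl <;> norm_num
  have hcosh : Real.cosh (σ * u) = Real.cosh u := by rcases hσ with rfl | rfl <;> simp
  have hsinh : Real.sinh (σ * u) = σ * Real.sinh u := by rcases hσ with rfl | rfl <;> simp
  have hv : 0 < Real.sinh (σ * u) := Real.sinh_pos_iff.2 hu
  have hy0 : 0 < y := by rw [hy]; positivity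
  set ρ := Real.arsinh (1 / Real.sinh (σ * u)) with hρ
  have hsinhρ : Real.sinh ρ = 1 / Real.sinh (σ * u) := Real.sinh_arsinh _
  have hρ0 : 0 < ρ := Real.arsinh_pos_iff.2 (by positivity)
  have hcoshρ : Real.cosh ρ = Real.cosh u / Real.sinh (σ * u) := by
    have hc := Real.cosh_pos u
    refine (sq_eq_sq₀ (Real.cosh_pos _).le (by positivity)).1 ?_
    rw [Real.cosh_sq, hsinhρ, ← hcosh, div_pow, div_pow, Real.cosh_sq (σ * u)]
    field_simp
    ring
  have hsinhτ : Real.sinh (ρ - 2 * s) = 1 / (y * Real.sinh (σ * u)) := by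
    rw [Real.sinh_sub, hsinhρ, hcoshρ, hy]
    field_simp
  have hτpos : 0 < Real.sinh (ρ - 2 * s) := by rw [hsinhτ]; positivity
  have hne : Real.sinh (ρ - (ρ - 2 * s)) ≠ 0 := by
    rw [sub_sub_cancel]; exact fun h => hs (by linarith [Real.sinh_eq_zero.1 h])
  have hy' : y = Real.sinh ρ / Real.sinh (ρ - 2 * s) := by
    rw [hsinhρ, hsinhτ]; field_simp
  have hw' : σ * w = -Real.sinh (ρ - (ρ - 2 * s)) / Real.sinh (ρ - 2 * s) := by
    rw [sub_sub_cancel, hsinhτ, hsinh, hw]; field_simp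
  obtain ⟨h1, h2⟩ := positive_formula hτpos (Real.sinh_pos_iff.2 hρ0) hne hy' hw'
  have e1 : σ * ((1 - y ^ 2 - w ^ 2) / (2 * y * w)) = Real.cosh (ρ - 2 * s) := by
    rw [← h1]; rcases hσ with rfl | rfl <;> ring
  have e2 : σ * ((1 - y ^ 2 + w ^ 2) / (2 * w)) = Real.cosh ρ := by
    rw [← h2]; rcases hσ with rfl | rfl <;> ring
  have hτ0 : 0 < ρ - 2 * s := Real.sinh_pos_iff.1 hτpos
  have hcoth : coth ρ = Real.cosh (σ * u) := by
    rw [coth, hsinhρ, hcoshρ, div_div_div_cancel_right₀ hv.ne', div_one, hcosh]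
  rw [e1, e2, Real.arcosh_cosh hρ0.le, Real.arcosh_cosh hτ0.le, hcoth, Real.arcosh_cosh hu.le,
    ← mul_assoc, hσ2, one_mul]
  exact ⟨Real.one_lt_cosh.2 hτ0.ne', Real.one_lt_cosh.2 hρ0.ne', rfl, by ring⟩

/-- Shows that the number s₂ of the formulas is the sign of u = ψ₀ + θ. -/
theorem sign_eq_of_mul {a c u s₁ : ℝ} (hs₁ : s₁ = 1 ∨ s₁ = -1) (hu : u ≠ 0) (ha : 0 < a)
    (hc : 0 < c) : (-s₁ * Real.sign (a * -(Real.sinh (2 * (s₁ * c)) * Real.sinh u)) = 1 ∨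
      -s₁ * Real.sign (a * -(Real.sinh (2 * (s₁ * c)) * Real.sinh u)) = -1) ∧
      0 < -s₁ * Real.sign (a * -(Real.sinh (2 * (s₁ * c)) * Real.sinh u)) * u := by
  have hc2 : 0 < Real.sinh (2 * c) := Real.sinh_pos_iff.2 (by linarith)
  have hneg : Real.sinh (2 * (-1 * c)) = -Real.sinh (2 * c) := by
    rw [neg_one_mul, mul_neg, Real.sinh_neg]
  rcases hs₁ with rfl | rfl <;> rcases hu.lt_or_gt with h | h
  · have := Real.sinh_neg_iff.2 h
    rw [Real.sign_of_pos (mul_pos ha (by rw [one_mul]; nlinarith))]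
    norm_num; exact h
  · have := Real.sinh_pos_iff.2 h
    rw [Real.sign_of_neg (mul_neg_of_pos_of_neg ha (by rw [one_mul, neg_lt_zero]; positivity))]
    norm_num; exact h
  · have := Real.sinh_neg_iff.2 h
    rw [hneg,
      Real.sign_of_neg (mul_neg_of_pos_of_neg ha (by nlinarith))]
    norm_num; exact h
  · have := Real.sinh_pos_iff.2 h
    rw [hneg,
      Real.sign_of_pos (mul_pos ha (by rw [neg_mul, neg_neg]; positivity))]
    norm_num; exact h

/-- The geodesics for positive curvature, in hyperbolic functions. -/
theorem geodesic_of_K_pos (hA : A.det ≠ 0) {Δ θ s₁ ψ t : ℝ} (hΔ : 0 < Δ)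
    (hs₁ : s₁ = 1 ∨ s₁ = -1) (hγ : A⁻¹ 1 0 = s₁ * Δ * Real.cosh θ)
    (hδ : A⁻¹ 1 1 = s₁ * Δ * Real.sinh θ) (ht : 0 ≤ t) (hex : GeodesicExists A ψ t) :
    0 < Real.cosh (2 * (s₁ * (Δ / 2 * t))) -
        Real.sinh (2 * (s₁ * (Δ / 2 * t))) * Real.cosh (ψ + θ) ∧
      (geodesic A ψ t).2 = 1 / (Real.cosh (2 * (s₁ * (Δ / 2 * t))) -
        Real.sinh (2 * (s₁ * (Δ / 2 * t))) * Real.cosh (ψ + θ)) ∧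
      slope₁ A * -lam₁ A (geodesic A ψ t) - slope₂ A * lam₂ A (geodesic A ψ t) =
        -(Real.sinh (2 * (s₁ * (Δ / 2 * t))) * Real.sinh (ψ + θ) * (geodesic A ψ t).2) := by
  have hs₁2 : s₁ * s₁ = 1 := by rcases hs₁ with rfl | rfl <;> norm_num
  have hn : slope₂ A = s₁ * (Δ / 2) * Real.exp θ := by
    rw [slope₂, ← Real.cosh_add_sinh, hγ, hδ]; ring
  have hm : slope₁ A = s₁ * (Δ / 2) * Real.exp (-θ) := by
    rw [slope₁, ← Real.cosh_sub_sinh, hγ, hδ]; ring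
  have hκ : slope₁ A * slope₂ A = (Δ / 2) ^ 2 := by
    rw [hn, hm]
    linear_combination (Δ / 2) ^ 2 * s₁ * s₁ * exp_neg_mul_exp θ + (Δ / 2) ^ 2 * hs₁2
  have hκ' : slope₂ A * slope₁ A = (Δ / 2) ^ 2 := by rw [mul_comm, hκ]
  have hpos : 0 < (Δ / 2) ^ 2 := by positivity
  have hroot : √((Δ / 2) ^ 2) = Δ / 2 := Real.sqrt_sq (by positivity)
  -- Both slopes carry the sign s₁; absorbing it into the time makes the formulas the same for both
  -- signs of γ.
  set s := s₁ * (Δ / 2 * t) with hs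
  have hC : gcos ((Δ / 2) ^ 2) t = Real.cosh s := by
    rw [gcos_of_pos hpos, hroot, hs]; rcases hs₁ with rfl | rfl <;> simp
  have hS : gsin ((Δ / 2) ^ 2) t = s₁ * Real.sinh s / (Δ / 2) := by
    rw [gsin_of_pos hpos, hroot, hs]; rcases hs₁ with rfl | rfl <;> simp
  have hne : slope₂ A * (Real.exp ψ * (s₁ * Real.sinh s / (Δ / 2))) =
      Real.exp (ψ + θ) * Real.sinh s := by
    rw [hn, Real.exp_add]
    field_simp
    linear_combination Real.sinh s * hs₁2
  have hmf : slope₁ A * (Real.exp (-ψ) * (s₁ * Real.sinh s / (Δ / 2))) =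
      Real.exp (-(ψ + θ)) * Real.sinh s := by
    rw [hm, neg_add, Real.exp_add]
    field_simp
    linear_combination Real.sinh s * hs₁2
  have hφ : coneDen (slope₁ A) (slope₂ A) (Real.exp ψ) t =
      Real.cosh s - Real.exp (ψ + θ) * Real.sinh s := by
    rw [coneDen, hκ, hC, hS, mul_assoc, hne]
  have hχ : coneDen (slope₂ A) (slope₁ A) (Real.exp (-ψ)) t =
      Real.cosh s - Real.exp (-(ψ + θ)) * Real.sinh s := by
    rw [coneDen, hκ', hC, hS, mul_assoc, hmf]
  obtain ⟨hφ0, hχ0⟩ := hex t ⟨ht, le_rfl⟩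
  have hy := hex.snd ht
  obtain ⟨hp, hr⟩ := lam_geodesic hA ψ t
  rw [hφ] at hφ0
  rw [hχ] at hχ0
  rw [hp, hr, coneCoord, coneCoord, hφ, hχ, hκ, hκ', hS, ← mul_div_assoc (slope₂ A),
    ← mul_div_assoc (slope₁ A), hne, hmf, hy, hφ, hχ]
  refine ⟨?_, ?_, ?_⟩
  · rw [← hyperbolic_product]; exact mul_pos hφ0 hχ0
  · rw [hyperbolic_product]
  · exact hyperbolic_combination hφ0.ne' hχ0.ne'

theorem ExpInv_of_K_pos (hdet : 0 < A.det) (ha : 0 ≤ A 0 0) (hK : 0 < K A) {x₁ y₁ : ℝ}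
    (hM : (x₁, y₁) ∈ M A) :
    let α := A⁻¹ 0 0
    let β := A⁻¹ 0 1
    let γ := A⁻¹ 1 0
    let δ := A⁻¹ 1 1
    let s₁ := Real.sign γ
    let Δ := √(γ ^ 2 - δ ^ 2)
    let θ := Real.arsinh (s₁ * δ / Δ)
    let l := (α * δ - β * γ) / Δ ^ 2
    let ν := (β * δ - α * γ) / Δ ^ 2
    let w := (x₁ + ν * (y₁ - 1)) / l
    let s₂ := -s₁ * Real.sign (l * w)
    let τ := Real.arcosh (s₂ * ((1 - y₁ ^ 2 - w ^ 2) / (2 * y₁ * w)))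
    let ρ := Real.arcosh (s₂ * ((1 - y₁ ^ 2 + w ^ 2) / (2 * w)))
    0 < Δ ∧ γ = s₁ * Δ * Real.cosh θ ∧ δ = s₁ * Δ * Real.sinh θ ∧ l ≠ 0 ∧
      (w = 0 → ExpInv A (x₁, y₁) = (-θ, s₁ * (Real.log y₁ / Δ))) ∧
      (w ≠ 0 →
        1 < s₂ * ((1 - y₁ ^ 2 - w ^ 2) / (2 * y₁ * w)) ∧
        1 < s₂ * ((1 - y₁ ^ 2 + w ^ 2) / (2 * w)) ∧
        ExpInv A (x₁, y₁) = (s₂ * Real.arcosh (coth ρ) - θ, s₁ * ((ρ - τ) / Δ))) := by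
  intro α β γ δ s₁ Δ θ l ν w s₂ τ ρ
  have hA := hdet.ne'
  obtain ⟨ψ, t, ht, hex, hq, hinv⟩ := exists_ExpInv_eq hdet ha hM
  have hsq : 0 < γ ^ 2 - δ ^ 2 := by rwa [K_eq_sub hA] at hK
  have hΔ : 0 < Δ := Real.sqrt_pos.2 hsq
  have hΔ2 : Δ ^ 2 = γ ^ 2 - δ ^ 2 := Real.sq_sqrt hsq.le
  have hγ0 : γ ≠ 0 := by
    intro h
    rw [h] at hsq
    linarith [sq_nonneg δ]
  have hs₁ : s₁ = 1 ∨ s₁ = -1 := (Real.sign_apply_eq_of_ne_zero γ hγ0).symm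
  have hs₁2 : s₁ * s₁ = 1 := by rcases hs₁ with h | h <;> rw [h] <;> norm_num
  have hs₁γ : 0 < s₁ * γ := Real.sign_mul_pos_of_ne_zero γ hγ0
  have hsinh : δ = s₁ * Δ * Real.sinh θ := by
    rw [Real.sinh_arsinh, mul_assoc, mul_div_cancel₀ _ hΔ.ne', ← mul_assoc, hs₁2, one_mul]
  have hcosh : γ = s₁ * Δ * Real.cosh θ := by
    have hc := Real.cosh_pos θ
    have : s₁ * γ = Δ * Real.cosh θ := by
      refine (sq_eq_sq₀ hs₁γ.le (by positivity)).1 ?_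
      rw [mul_pow Δ, Real.cosh_sq]
      have h2 : δ ^ 2 = Δ ^ 2 * Real.sinh θ ^ 2 := by
        conv_lhs => rw [hsinh]
        linear_combination Δ ^ 2 * Real.sinh θ ^ 2 * hs₁2
      linear_combination γ ^ 2 * hs₁2 - hΔ2 + h2
    rw [mul_assoc, ← this, ← mul_assoc, hs₁2, one_mul]
  have hD : 0 < α * δ - β * γ :=
    pos_of_mul_pos_right ((det_mul_det_inv hA).symm ▸ one_pos) hdet.le
  have hl : 0 < l := div_pos hD (pow_pos hΔ 2)
  obtain ⟨hden, hy, hw⟩ := geodesic_of_K_pos hA hΔ hs₁ hcosh hsinh ht.le hex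
  rw [hq] at hy hw
  change y₁ = _ at hy
  set c := Δ / 2 * t with hc
  have hc0 : 0 < c := by positivity
  have hw' : w = -(Real.sinh (2 * (s₁ * c)) * Real.sinh (ψ + θ) * y₁) := by
    have h := cone_combination hA (d := -Δ ^ 2) (neg_ne_zero.2 (pow_ne_zero 2 hΔ.ne'))
      (by rw [hΔ2]; ring) (x₁, y₁)
    rw [div_neg, div_neg, neg_mul, sub_neg_eq_add, div_neg] at h
    change -w = _ at h
    change _ = -(Real.sinh (2 * (s₁ * c)) * Real.sinh (ψ + θ) * y₁) at hw
    rw [← hw]; linarith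
  have hs0 : s₁ * c ≠ 0 := mul_ne_zero (left_ne_zero_of_mul_eq_one hs₁2) hc0.ne'
  have hsinh0 : Real.sinh (2 * (s₁ * c)) ≠ 0 := fun h =>
    hs0 (by linarith [Real.sinh_eq_zero.1 h])
  have hy0 : 0 < y₁ := by rw [hy]; exact one_div_pos.2 hden
  refine ⟨hΔ, hcosh, hsinh, hl.ne', fun h0 => ?_, fun h0 => ?_⟩
  · rw [hw', neg_eq_zero, mul_eq_zero, mul_eq_zero, Real.sinh_eq_zero (x := ψ + θ)] at h0
    -- w vanishes only for ψ₀ = -θ, and then y = exp(s₁ Δ t).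
    have hu : ψ + θ = 0 := (h0.resolve_right hy0.ne').resolve_left hsinh0
    rw [hu, Real.cosh_zero, mul_one, Real.cosh_sub_sinh, one_div, ← Real.exp_neg, neg_neg] at hy
    rw [hinv, hy, Real.log_exp, Prod.mk.injEq]
    refine ⟨by linarith, ?_⟩
    rw [hc]
    field_simp
    linear_combination -hs₁2
  · have hu : ψ + θ ≠ 0 := by
      rintro hu
      exact h0 (by rw [hw', hu, Real.sinh_zero, mul_zero, zero_mul, neg_zero])
    have hlw : l * w = l * y₁ * -(Real.sinh (2 * (s₁ * c)) * Real.sinh (ψ + θ)) := by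
      rw [hw']; ring
    obtain ⟨h1, h2⟩ := sign_eq_of_mul hs₁ hu (mul_pos hl hy0) hc0
    rw [← hlw] at h1 h2
    obtain ⟨k1, k2, k3, k4⟩ := hyperbolic_inverse hs0 h1 h2 hden hy hw'
    refine ⟨k1, k2, ?_⟩
    rw [hinv, Prod.mk.injEq]
    refine ⟨eq_sub_of_add_eq k3.symm, ?_⟩
    change ρ - τ = _ at k4
    rw [k4, hc]
    field_simp
    linear_combination -hs₁2

theorem ExpInv_of_K_zero (hdet : 0 < A.det) (ha : 0 ≤ A 0 0) (hK : K A = 0) {x₁ y₁ : ℝ}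
    (hM : (x₁, y₁) ∈ M A) :
    let α := A⁻¹ 0 0
    let β := A⁻¹ 0 1
    let γ := A⁻¹ 1 0
    let s₁ := Real.sign γ
    let f := -((α - s₁ * β) / (2 * γ))
    let g := -((α + s₁ * β) / (2 * γ))
    let w := (x₁ - g * (1 - y₁)) / f
    let τ := √(w / (y₁ - y₁ ^ 2))
    let ρ := √(w * y₁ / (1 - y₁))
    γ ≠ 0 ∧ f ≠ 0 ∧ y₁ ≠ 1 ∧ 0 < w / (y₁ - y₁ ^ 2) ∧ 0 < w * y₁ / (1 - y₁) ∧
      ExpInv A (x₁, y₁) = (-s₁ * Real.log ρ, (ρ - τ) / γ) := by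
  intro α β γ s₁ f g w τ ρ
  have hA := hdet.ne'
  obtain ⟨ψ, t, ht, hex, hq, hinv⟩ := exists_ExpInv_eq hdet ha hM
  obtain ⟨hp, hr⟩ := lam_geodesic hA ψ t
  obtain ⟨hφ, hχ⟩ := hex t ⟨ht.le, le_rfl⟩
  have hy := hex.snd ht.le
  have hx : x₁ = _ := (congrArg Prod.fst (ofCone_lam hA (x₁, y₁))).symm
  have hy' : y₁ = _ := snd_eq_cone hA (x₁, y₁)
  rw [hq] at hp hr hy
  change y₁ = _ at hy
  change x₁ = ((α - β) * -lam₁ A (x₁, y₁) + (α + β) * lam₂ A (x₁, y₁)) / 2 at hx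
  have hδ : 0 ≤ A⁻¹ 1 1 := by rw [inv_one_one]; positivity
  have hsq : γ ^ 2 = A⁻¹ 1 1 ^ 2 := by rw [K_eq_sub hA] at hK; linarith
  have hD : α * A⁻¹ 1 1 - β * γ ≠ 0 := right_ne_zero_of_mul_eq_one (det_mul_det_inv hA)
  have hγ : γ ≠ 0 := by
    intro h
    rw [h, zero_pow two_ne_zero, eq_comm, sq_eq_zero_iff] at hsq
    exact hD (by rw [h, hsq]; ring)
  -- As δ ≥ 0 and δ² = γ², the sign of γ decides which slope vanishes. One denominator is then
  -- identically 1 and the other is affine in t; the two cases exchange exp ψ and exp(-ψ), which is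
  -- the sign s₁ in the formula for ψ₀.
  rcases hγ.lt_or_gt with hlt | hgt
  · have hs₁ : s₁ = -1 := Real.sign_of_neg hlt
    have hδγ : A⁻¹ 1 1 = -γ := (sq_eq_sq₀ hδ (by linarith)).1 (by rw [← hsq, neg_sq])
    have hm : slope₁ A = γ := by rw [slope₁, hδγ]; ring
    have hn : slope₂ A = 0 := by rw [slope₂, hδγ]; ring
    have hαβ : α + β ≠ 0 := fun h => hD (by rw [hδγ]; linear_combination -γ * h)
    simp only [coneCoord, coneDen, hm, hn, mul_zero, zero_mul, gcos_zero_left, gsin_zero_left,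
      sub_zero, div_one, one_mul, add_zero] at hp hr hφ hχ hy hy'
    have hf : f = -((α + β) / (2 * γ)) := by simp only [f, hs₁]; ring
    have hf0 : f ≠ 0 := by
      rw [hf]; exact neg_ne_zero.2 (div_ne_zero hαβ (mul_ne_zero two_ne_zero hγ))
    have hw : w = -γ * (Real.exp ψ * t) := by
      rw [← hr, div_eq_iff hf0, hf]
      simp only [g, hs₁]
      generalize lam₁ A (x₁, y₁) = p, lam₂ A (x₁, y₁) = r at hx hy' ⊢
      rw [hy', hx]
      field_simp
      ring
    obtain ⟨h1, h2, h3, h4, h5⟩ := zero_formula hγ (Real.exp_pos ψ) (exp_neg_mul_exp ψ) ht hχ hy hw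
    refine ⟨hγ, hf0, h1, h2, h3, ?_⟩
    rw [hinv, Prod.mk.injEq]
    refine ⟨?_, h5.symm⟩
    simp only [ρ]
    rw [h4, Real.log_exp, hs₁]; ring
  · have hs₁ : s₁ = 1 := Real.sign_of_pos hgt
    have hδγ : A⁻¹ 1 1 = γ := (sq_eq_sq₀ hδ hgt.le).1 hsq.symm
    have hm : slope₁ A = 0 := by rw [slope₁, hδγ]; ring
    have hn : slope₂ A = γ := by rw [slope₂, hδγ]; ring
    have hαβ : α - β ≠ 0 := fun h => hD (by rw [hδγ]; linear_combination γ * h)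
    simp only [coneCoord, coneDen, hm, hn, mul_zero, zero_mul, gcos_zero_left, gsin_zero_left,
      sub_zero, div_one, mul_one, add_zero] at hp hr hφ hχ hy hy'
    have hf : f = -((α - β) / (2 * γ)) := by simp only [f, hs₁]; ring
    have hf0 : f ≠ 0 := by
      rw [hf]; exact neg_ne_zero.2 (div_ne_zero hαβ (mul_ne_zero two_ne_zero hγ))
    have hw : w = -γ * (Real.exp (-ψ) * t) := by
      rw [← hp, div_eq_iff hf0, hf]
      simp only [g, hs₁]
      generalize lam₁ A (x₁, y₁) = p, lam₂ A (x₁, y₁) = r at hx hy' ⊢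
      rw [hy', hx]
      field_simp
      ring
    obtain ⟨h1, h2, h3, h4, h5⟩ :=
      zero_formula hγ (Real.exp_pos (-ψ)) (exp_mul_exp_neg ψ) ht hφ hy hw
    refine ⟨hγ, hf0, h1, h2, h3, ?_⟩
    rw [hinv, Prod.mk.injEq]
    refine ⟨?_, h5.symm⟩
    simp only [ρ]
    rw [h4, Real.log_exp, hs₁]; ring

theorem ExpInv_isMaximizer (hdet : 0 < A.det) (ha : 0 ≤ A 0 0) {q₁ : ℝ × ℝ} (hq : q₁ ∈ M A) :
    let ψ₀ := (ExpInv A q₁).1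
    let t₁ := (ExpInv A q₁).2
    IsMaximizer A Id q₁ t₁ (fun t => Exp A (ψ₀, t)) ∧
      IsArclength A t₁ (fun t => Exp A (ψ₀, t)) ∧
      ∀ (T : ℝ) (q : ℝ → ℝ × ℝ), IsMaximizer A Id q₁ T q → IsArclength A T q →
        T = t₁ ∧ ∀ t ∈ Set.Icc 0 t₁, q t = Exp A (ψ₀, t) := by
  obtain ⟨ψ, t, ht, hex, rfl, hinv⟩ := exists_ExpInv_eq hdet ha hq
  rw [hinv, ← Exp_eq hdet.ne' ht.le hex]
  exact isMaximizer_Exp hdet.ne' ((mem_N_iff hdet.ne').2 ⟨ht, hex⟩)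

end Inverse

end AffLorentz

/-! ### The theorem -/

theorem mainTheorem2 (A : Matrix (Fin 2) (Fin 2) ℝ) (hdet : 0 < A.det) (ha : 0 ≤ A 0 0) :
    let α := A⁻¹ 0 0
    let β := A⁻¹ 0 1
    let γ := A⁻¹ 1 0
    let δ := A⁻¹ 1 1
    let s₁ := Real.sign γ
    Set.BijOn (AffLorentz.Exp A) (AffLorentz.N A) (AffLorentz.M A) ∧
    -- the case of negative curvature
    (AffLorentz.K A < 0 → ∀ x₁ y₁ : ℝ, (x₁, y₁) ∈ AffLorentz.M A →
      let Δ := √(δ ^ 2 - γ ^ 2)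
      let θ := Real.arsinh (γ / Δ)
      let l := (α * δ - β * γ) / Δ ^ 2
      let ν := (β * δ - α * γ) / Δ ^ 2
      let w := (x₁ - ν * (y₁ - 1)) / l
      let τ := Real.arcsin ((y₁ ^ 2 + w ^ 2 - 1) / (2 * y₁ * w))
      let ρ := Real.arcsin ((y₁ ^ 2 - w ^ 2 - 1) / (2 * w))
      0 < Δ ∧ δ = Δ * Real.cosh θ ∧ γ = Δ * Real.sinh θ ∧ l ≠ 0 ∧ w ≠ 0 ∧
      (y₁ ^ 2 + w ^ 2 - 1) / (2 * y₁ * w) ∈ Set.Ioo (-1 : ℝ) 1 ∧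
      (y₁ ^ 2 - w ^ 2 - 1) / (2 * w) ∈ Set.Ioo (-1 : ℝ) 1 ∧
      AffLorentz.ExpInv A (x₁, y₁) = (Real.arsinh (Real.tan ρ) - θ, (τ - ρ) / Δ)) ∧
    -- the case of positive curvature
    (0 < AffLorentz.K A → ∀ x₁ y₁ : ℝ, (x₁, y₁) ∈ AffLorentz.M A →
      let Δ := √(γ ^ 2 - δ ^ 2)
      let θ := Real.arsinh (s₁ * δ / Δ)
      let l := (α * δ - β * γ) / Δ ^ 2
      let ν := (β * δ - α * γ) / Δ ^ 2
      let w := (x₁ + ν * (y₁ - 1)) / l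
      let s₂ := -s₁ * Real.sign (l * w)
      let τ := Real.arcosh (s₂ * ((1 - y₁ ^ 2 - w ^ 2) / (2 * y₁ * w)))
      let ρ := Real.arcosh (s₂ * ((1 - y₁ ^ 2 + w ^ 2) / (2 * w)))
      0 < Δ ∧ γ = s₁ * Δ * Real.cosh θ ∧ δ = s₁ * Δ * Real.sinh θ ∧ l ≠ 0 ∧
      (w = 0 → AffLorentz.ExpInv A (x₁, y₁) = (-θ, s₁ * (Real.log y₁ / Δ))) ∧
      (w ≠ 0 →
        1 < s₂ * ((1 - y₁ ^ 2 - w ^ 2) / (2 * y₁ * w)) ∧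
        1 < s₂ * ((1 - y₁ ^ 2 + w ^ 2) / (2 * w)) ∧
        AffLorentz.ExpInv A (x₁, y₁) =
          (s₂ * Real.arcosh (AffLorentz.coth ρ) - θ, s₁ * ((ρ - τ) / Δ)))) ∧
    -- the case of zero curvature
    (AffLorentz.K A = 0 → ∀ x₁ y₁ : ℝ, (x₁, y₁) ∈ AffLorentz.M A →
      let f := -((α - s₁ * β) / (2 * γ))
      let g := -((α + s₁ * β) / (2 * γ))
      let w := (x₁ - g * (1 - y₁)) / f
      let τ := √(w / (y₁ - y₁ ^ 2))
      let ρ := √(w * y₁ / (1 - y₁))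
      γ ≠ 0 ∧ f ≠ 0 ∧ y₁ ≠ 1 ∧ 0 < w / (y₁ - y₁ ^ 2) ∧ 0 < w * y₁ / (1 - y₁) ∧
      AffLorentz.ExpInv A (x₁, y₁) = (-s₁ * Real.log ρ, (ρ - τ) / γ)) ∧
    -- the unique arclength-parametrized maximizer
    (∀ q₁ ∈ AffLorentz.M A,
      let ψ₀ := (AffLorentz.ExpInv A q₁).1
      let t₁ := (AffLorentz.ExpInv A q₁).2
      AffLorentz.IsMaximizer A AffLorentz.Id q₁ t₁ (fun t => AffLorentz.Exp A (ψ₀, t)) ∧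
      AffLorentz.IsArclength A t₁ (fun t => AffLorentz.Exp A (ψ₀, t)) ∧
      ∀ (T : ℝ) (q : ℝ → ℝ × ℝ), AffLorentz.IsMaximizer A AffLorentz.Id q₁ T q →
        AffLorentz.IsArclength A T q →
        T = t₁ ∧ ∀ t ∈ Set.Icc 0 t₁, q t = AffLorentz.Exp A (ψ₀, t)) := by
  intro α β γ δ s₁
  refine ⟨?_, fun hK x₁ y₁ hM => AffLorentz.ExpInv_of_K_neg hdet ha hK hM,
    fun hK x₁ y₁ hM => AffLorentz.ExpInv_of_K_pos hdet ha hK hM,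
    fun hK x₁ y₁ hM => AffLorentz.ExpInv_of_K_zero hdet ha hK hM,
    fun q₁ hq => AffLorentz.ExpInv_isMaximizer hdet ha hq⟩
  rw [AffLorentz.M_eq_future hdet ha]
  exact AffLorentz.bijOn_Exp_future hdet.ne'
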